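/- Let $G:\mathbb{R}\to\mathbb{R}$ be nonpositive, even, $G\in L^1(\mathbb{R})\cap C^1(\mathbb{R})$, with a unique local (and global) minimum (located at $x=0$), and with $G(0)<-2$. Assume that $G$ is real-analytic with $G'(x)>0$ at each $x>0$, let $G^{-1}$ denote the inverse of $G|_{[0,\infty)}$, and assume that $\mathscr{G}(m):=\sqrt{m}\sqrt{G(0)^2-m}\,/\,(2G'(G^{-1}(-\sqrt{m})))$, $0<m<G(0)^2$, can be continued analytically to neighborhoods of $m=0$ and $m=G(0)^2$ with $\mathscr{G}(0)>0$ and $\mathscr{G}(G(0)^2)>0$. Put $x_{\mathrm{crit}}:=G^{-1}(-2)$, $\nu:=1/(12G'(x_{\mathrm{crit}}))$, $\Delta x:=x-x_{\mathrm{crit}}$. With principal branches, for $|\arg(-w)|<\pi$ set $E(w):=\tfrac{i}{4}[(-w)^{1/2}+(-w)^{-1/2}]$, $D(w):=\tfrac{i}{4}[(-w)^{1/2}-(-w)^{-1/2}]$, and, for $x,t\in\mathbb{R}$, $Q(w;x,t):=E(w)x+D(w)t$. Let $$\Psi(iv/4):=\tfrac12\int_0^{G^{-1}(-v)}\sqrt{G(s)^2-v^2}\,ds,\quad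 0<v\le -G(0),\qquad \theta_0(w):=\Psi(E(w)).$$ Let $\mathfrak{a}:=-\tfrac14(\sqrt{G(0)^2-4}-G(0))^2$, $\mathfrak{b}:=1/\mathfrak{a}$ (so $\mathfrak{a}<-1<\mathfrak{b}<0$), and let $P_\infty:=[\mathfrak{a},\mathfrak{b}]\cup S^1$, with $(\mathfrak{a},-1)$ and $(-1,\mathfrak{b})$ both oriented toward $-1$ and the upper and lower unit semicircles oriented from $-1$ to $1$. Off $P_\infty\cup\mathbb{R}_+$ set $$L(w):=\frac{(-w)^{1/2}}{\pi}\int_{P_\infty}\frac{\theta_0(y)}{(-y)^{1/2}}\frac{dy}{y-w},$$ $$\mathfrak{m}(w):=\frac{w}{2\pi}\int_{\mathfrak{a}}^{\mathfrak{b}}\frac{\theta_0(s)\,ds}{(-s)^{1/2}(s-w)}+\begin{cases}-\tfrac12(x+t)w,&|w|<1,\\ \tfrac12(t-x),&|w|>1,\end{cases}$$ and $\mathfrak{g}(w;x,t):=\tfrac12L(w)\pm(-w)^{-1/2}\mathfrak{m}(w)$, with the sign $+$ for $|w|>1$ and $-$ for $|w|<1$. Let $L_\pm$ be the boundary values of $L$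 on $(\mathfrak{a},-1)$ from above ($+$) and below ($-$), let $\overline{L}:=\tfrac12(L_++L_-)$, and define $$k(w;x,t):=2iQ(w;x,t)+\overline{L}(w)-2\mathfrak{g}(w;x,t),\qquad \mathfrak{a}<w<-1,$$ where $\mathfrak{g}$ is extended continuously across $(\mathfrak{a},-1)$. Then $x_{\mathrm{crit}}>0$, $G(x_{\mathrm{crit}})=-2$, $\nu>0$, and for real $w<-1$ close enough to $-1$ the above limits exist. There is a disc centered at $w=-1$, independent of $x$ and $t$, to which $k(w;x,t)$ continues analytically from $w<-1$ for all real $x,t$. All Taylor coefficients of $k(\cdot;x,t)$ at $w=-1$ are (affine) linear functions of $\Delta x$ and $t$, and $$\begin{aligned}k(w;x,t)=&-t+\tfrac12\Delta x\,(w+1)+\left[\tfrac14\Delta x-\tfrac18t\right](w+1)^2+\left[\tfrac3{16}\Delta x-\tfrac18t+\nu\right](w+1)^3\\&+\left[\tfrac5{32}\Delta x-\tfrac{15}{128}t+\tfrac32\nu\right](w+1)^4+\mathcal{O}((w+1)^5),\qquad w\to-1,\end{aligned}$$ where the error term is uniform for bounded $\Delta x$ and $t$. -/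

import Mathlib

open Filter Topology Set

noncomputable section

namespace SineGordon

/-- The inverse of `G` restricted to `[0, ∞)`; for the data considered below it is a genuine
inverse on `[G 0, 0)`. -/
def Ginv (G : ℝ → ℝ) (y : ℝ) : ℝ := Function.invFunOn G (Ici 0) y

/-- The function `𝒢(m) = √m √(G(0)² - m) / (2 G'(G⁻¹(-√m)))`, used for `0 < m < G(0)²`. -/
def scriptG (G : ℝ → ℝ) (m : ℝ) : ℝ :=
  Real.sqrt m * Real.sqrt (G 0 ^ 2 - m) / (2 * deriv G (Ginv G (-Real.sqrt m)))

/-- The standing assumptions on the initial impulse profile `G`. -/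
structure IsImpulseProfile (G : ℝ → ℝ) : Prop where
  nonpos : ∀ x, G x ≤ 0
  integrable : MeasureTheory.Integrable G
  contDiff : ContDiff ℝ 1 G
  /-- There is a unique local minimum, and it is a global one. -/
  unique_min : ∃ x₀, (∀ y, G x₀ ≤ G y) ∧ ∀ y, IsLocalMin G y → y = x₀
  even : ∀ x, G (-x) = G x
  analytic : AnalyticOnNhd ℝ G (Ioi 0)
  deriv_pos : ∀ x, 0 < x → 0 < deriv G x
  /-- `𝒢` continues analytically to neighborhoods of both endpoints of `[0, G(0)²]`, with
  positive values there. -/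
  scriptG_nice : ∃ Γ : ℝ → ℝ, AnalyticOnNhd ℝ Γ (Icc 0 (G 0 ^ 2)) ∧
    (∀ m ∈ Ioo 0 (G 0 ^ 2), Γ m = scriptG G m) ∧ 0 < Γ 0 ∧ 0 < Γ (G 0 ^ 2)
  kinks : G 0 < -2

/-- `x_crit = G⁻¹(-2)`. -/
def xcrit (G : ℝ → ℝ) : ℝ := Ginv G (-2)

/-- `ν = 1 / (12 G'(x_crit))`. -/
def nu (G : ℝ → ℝ) : ℝ := 1 / (12 * deriv G (xcrit G))

/-- `Ψ(λ) = ½ ∫₀^{G⁻¹(-v)} √(G(s)² - v²) ds` for `λ = iv/4`, `0 < v ≤ -G(0)`.  It is only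
evaluated at such purely imaginary `λ`, where `v = 4 Im λ`. -/
def Psi (G : ℝ → ℝ) (l : ℂ) : ℝ :=
  (1 / 2) * ∫ s in (0 : ℝ)..(Ginv G (-(4 * l.im))), Real.sqrt (G s ^ 2 - (4 * l.im) ^ 2)

/-- The principal branch of `(-w)^{1/2}`. -/
def rt (w : ℂ) : ℂ := (-w) ^ (1 / 2 : ℂ)

def E (w : ℂ) : ℂ := Complex.I / 4 * (rt w + (rt w)⁻¹)

def D (w : ℂ) : ℂ := Complex.I / 4 * (rt w - (rt w)⁻¹)

def Q (x t : ℝ) (w : ℂ) : ℂ := E w * x + D w * t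

/-- `θ₀(w) = Ψ(E(w))`, evaluated only on the contour `P_∞` below, where `E` is purely
imaginary. -/
def theta0 (G : ℝ → ℝ) (w : ℂ) : ℂ := (Psi G (E w) : ℂ)

def endA (G : ℝ → ℝ) : ℝ := -(1 / 4) * (Real.sqrt (G 0 ^ 2 - 4) - G 0) ^ 2

def endB (G : ℝ → ℝ) : ℝ := -(1 / 4) * (Real.sqrt (G 0 ^ 2 - 4) + G 0) ^ 2

/-- The contour `P_∞ = [𝔞, 𝔟] ∪ S¹` as a point set. -/
def PInf (G : ℝ → ℝ) : Set ℂ :=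
  Metric.sphere (0 : ℂ) 1 ∪ (fun s : ℝ => (s : ℂ)) '' Icc (endA G) (endB G)

/-- The integral over `P_∞` with its orientation: both intervals `(𝔞, -1)` and `(-1, 𝔟)` are
oriented toward `-1`, and the upper and lower unit semicircles from `-1` to `1`. -/
def intPInf (G : ℝ → ℝ) (f : ℂ → ℂ) : ℂ :=
  (∫ s in (endA G)..(-1), f (s : ℂ)) + (∫ s in (endB G)..(-1), f (s : ℂ)) +
  (∫ φ in Real.pi..0, f (Complex.exp (φ * Complex.I)) *
    (Complex.I * Complex.exp (φ * Complex.I))) +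
  (∫ φ in (-Real.pi)..0, f (Complex.exp (φ * Complex.I)) *
    (Complex.I * Complex.exp (φ * Complex.I)))

/-- The Cauchy integral `L(w)`, for `w` off `P_∞ ∪ ℝ₊`. -/
def L (G : ℝ → ℝ) (w : ℂ) : ℂ :=
  rt w / Real.pi * intPInf G (fun y => theta0 G y / rt y / (y - w))

/-- The function `𝔪(w)`, for `w` off `P_∞`. -/
def mfun (G : ℝ → ℝ) (x t : ℝ) (w : ℂ) : ℂ :=
  w / (2 * Real.pi) * (∫ s in (endA G)..(endB G), theta0 G s / (rt s * (s - w))) +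
    if ‖w‖ < 1 then -((x + t) / 2) * w else (t - x) / 2

/-- The function `𝔥(w)`, for `w` off `P_∞ ∪ ℝ₊`. -/
def hfun (G : ℝ → ℝ) (x t : ℝ) (w : ℂ) : ℂ :=
  if ‖w‖ < 1 then -((rt w)⁻¹ * mfun G x t w) else (rt w)⁻¹ * mfun G x t w

/-- The function `𝔤(w) = L(w)/2 + 𝔥(w)`, for `w` off `P_∞ ∪ ℝ₊`. -/
def gfun (G : ℝ → ℝ) (x t : ℝ) (w : ℂ) : ℂ := L G w / 2 + hfun G x t w

/-- `κ = 2iQ(w) + L̄(w) - 2𝔤(w)` at a real point `w ∈ (𝔞, -1)`.  Here `L̄ = (L₊ + L₋)/2` is the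
mean of the boundary values of `L` from the upper (left) and lower (right) half-planes, and `𝔤(w)`
is the value at `w` of the continuous extension of `𝔤` across `(𝔞, -1)`; all these limits are
required to exist. -/
def IsPhaseValue (G : ℝ → ℝ) (x t w : ℝ) (κ : ℂ) : Prop :=
  endA G < w ∧ w < -1 ∧ ∃ Lp Lm g : ℂ,
    Tendsto (L G) (𝓝[{z : ℂ | 0 < z.im}] (w : ℂ)) (𝓝 Lp) ∧
    Tendsto (L G) (𝓝[{z : ℂ | z.im < 0}] (w : ℂ)) (𝓝 Lm) ∧
    Tendsto (gfun G x t) (𝓝[(PInf G)ᶜ] (w : ℂ)) (𝓝 g) ∧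
    κ = 2 * Complex.I * Q x t w + (Lp + Lm) / 2 - 2 * g

/-- The explicit quartic Taylor polynomial, with `dx` standing for `Δx` and `z` for `w + 1`. -/
def taylorPoly (ν dx t : ℝ) (z : ℂ) : ℂ :=
  -t + (1 / 2) * dx * z + ((1 / 4) * dx - (1 / 8) * t) * z ^ 2 +
    ((3 / 16) * dx - (1 / 8) * t + ν) * z ^ 3 +
    ((5 / 32) * dx - (15 / 128) * t + (3 / 2) * ν) * z ^ 4

end SineGordon

end

/-! ### The inverse of the profile and the integral defining `Psi`. -/

namespace SineGordon

open MeasureTheory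

variable {G : ℝ → ℝ}

namespace IsImpulseProfile

/-! On `(𝔞, -1)` the phase has a closed form. Write `r = √(-w)`, `p = r - r⁻¹` and `c(x)² = G(x)² -
4`. Then `k = -(p/2) Δx - ((r + r⁻¹)/2) t - ½ ∫₀^{x_crit} √(p² - c(x)²) dx`, where the root is taken
to be `0` when its argument is negative.

To obtain it, the orientation of the contour is used to write `L` as the Cauchy integral over all of
`[𝔞, 𝔟]`, minus twice the part over `(-1, 𝔟)`, plus a circular part. The last two are continuous at
`w`, and outside the unit disc the function `𝔪` cancels the full segment integral in `𝔤`
(`gfun_eq`). Hence `k` involves `θ₀` only through the mean of the two boundary values of the segment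
integral. Since `G² - (r + r⁻¹)² = c² - p²`, `θ₀` is on the segment an average over `x` of truncated
semicircle densities in `p`; Fubini and an elementary integral (`integral_kernel`) give the segment
integral explicitly (`integral_theta0`). In the mean of its boundary values the imaginary parts of
the square roots cancel, leaving the truncated real root (`segLim_add`, `isPhaseValue`).

For small `p > 0` only `x` near `x_crit` contribute to the last integral. The substitution `y =
G(x)² - 4` turns it into `p³ ∫₀¹ √(1 - τ) h(p² τ) dτ = p³ H(p²)`, where the Jacobian `h` is analytic
at `0` because `𝒢` is analytic (`exists_jacobian`, `exists_holomorphic_average`). So `k` continues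
to `A Δx + B t + C`, with `A`, `B`, `C` holomorphic near `-1` and independent of `x` and `t`. This
yields both the affine coefficients and the uniform error; `H(0) = (2/3) h(0) = 2ν`, and expanding
`(-w)^{-1/2}` gives the stated terms. -/

theorem continuous (hG : IsImpulseProfile G) : Continuous G := hG.contDiff.continuous

theorem strictMonoOn (hG : IsImpulseProfile G) : StrictMonoOn G (Ici 0) :=
  strictMonoOn_of_deriv_pos (convex_Ici 0) hG.continuous.continuousOn fun x hx => by
    rw [interior_Ici] at hx
    exact hG.deriv_pos x hx

/-- If a negative level were never reached, `G` would stay below it everywhere and could not be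
integrable. Evenness moves the point to the positive half-line, and the intermediate value theorem
finishes. -/
theorem exists_eq (hG : IsImpulseProfile G) {y : ℝ} (hy : y ∈ Ico (G 0) 0) :
    ∃ x ∈ Ici (0 : ℝ), G x = y := by
  have h1 : ∃ x, y ≤ G x := by
    by_contra! h
    have hc : Integrable (fun _ : ℝ => y) := hG.integrable.mono aestronglyMeasurable_const <|
      Eventually.of_forall fun x => by
        rw [Real.norm_eq_abs, Real.norm_eq_abs, abs_of_neg hy.2, abs_of_nonpos (hG.nonpos x)]
        linarith [h x]
    rw [integrable_const_iff_isFiniteMeasure hy.2.ne] at hc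
    exact (measure_lt_top (volume : Measure ℝ) univ).ne Real.volume_univ
  obtain ⟨x, hx⟩ := h1
  have h2 : y ≤ G |x| := by
    rcases abs_choice x with h | h <;> rw [h]
    · exact hx
    · rwa [hG.even]
  obtain ⟨u, hu, rfl⟩ := intermediate_value_Icc (abs_nonneg x) hG.continuous.continuousOn
    (show y ∈ Icc (G 0) (G |x|) from ⟨hy.1, h2⟩)
  exact ⟨u, hu.1, rfl⟩

theorem Ginv_nonneg (hG : IsImpulseProfile G) {y : ℝ} (hy : y ∈ Ico (G 0) 0) : 0 ≤ Ginv G y :=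
  Function.invFunOn_mem (hG.exists_eq hy)

theorem apply_Ginv (hG : IsImpulseProfile G) {y : ℝ} (hy : y ∈ Ico (G 0) 0) : G (Ginv G y) = y :=
  Function.invFunOn_eq (hG.exists_eq hy)

theorem Ginv_apply (hG : IsImpulseProfile G) {x : ℝ} (hx : 0 ≤ x) : Ginv G (G x) = x :=
  hG.strictMonoOn.injOn.leftInvOn_invFunOn hx

theorem xcrit_nonneg (hG : IsImpulseProfile G) : 0 ≤ xcrit G :=
  hG.Ginv_nonneg ⟨hG.kinks.le, by norm_num⟩

theorem apply_xcrit (hG : IsImpulseProfile G) : G (xcrit G) = -2 :=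
  hG.apply_Ginv ⟨hG.kinks.le, by norm_num⟩

theorem xcrit_pos (hG : IsImpulseProfile G) : 0 < xcrit G := by
  refine hG.xcrit_nonneg.lt_of_ne fun h => ?_
  have h1 := hG.apply_xcrit
  rw [← h] at h1
  exact hG.kinks.ne h1

theorem nu_pos (hG : IsImpulseProfile G) : 0 < nu G := by
  have := hG.deriv_pos _ hG.xcrit_pos
  unfold nu
  positivity

theorem le_neg_two (hG : IsImpulseProfile G) {x : ℝ} (hx : x ∈ Icc 0 (xcrit G)) : G x ≤ -2 := by
  rw [← hG.apply_xcrit]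
  exact hG.strictMonoOn.monotoneOn hx.1 hG.xcrit_nonneg hx.2

theorem apply_zero_le (hG : IsImpulseProfile G) {x : ℝ} (hx : 0 ≤ x) : G 0 ≤ G x :=
  hG.strictMonoOn.monotoneOn self_mem_Ici hx hx

/-- Past the turning point `G² ≤ v²`, and the real square root truncates to `0`. This makes the
upper limit in `Psi` immaterial, so it can be replaced by one not depending on `v`. -/
theorem sqrt_eq_zero (hG : IsImpulseProfile G) {v x : ℝ} (hv : v ∈ Ioc 0 (-G 0))
    (hx : Ginv G (-v) ≤ x) : Real.sqrt (G x ^ 2 - v ^ 2) = 0 := by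
  have hy : -v ∈ Ico (G 0) 0 := ⟨by linarith [hv.2], by linarith [hv.1]⟩
  have h0 := hG.Ginv_nonneg hy
  have h1 : -v ≤ G x := by
    rw [← hG.apply_Ginv hy]
    exact hG.strictMonoOn.monotoneOn h0 (h0.trans hx) hx
  apply Real.sqrt_eq_zero_of_nonpos
  nlinarith [hG.nonpos x]

theorem continuous_sqrt (hG : IsImpulseProfile G) (v : ℝ) :
    Continuous fun x => Real.sqrt (G x ^ 2 - v ^ 2) :=
  ((hG.continuous.pow 2).sub continuous_const).sqrt

theorem integral_Ginv_eq (hG : IsImpulseProfile G) {v X : ℝ} (hv : v ∈ Ioc 0 (-G 0))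
    (hX : Ginv G (-v) ≤ X) :
    ∫ s in (0 : ℝ)..(Ginv G (-v)), Real.sqrt (G s ^ 2 - v ^ 2) =
      ∫ s in (0 : ℝ)..X, Real.sqrt (G s ^ 2 - v ^ 2) := by
  have hi : ∀ a b, IntervalIntegrable (fun x => Real.sqrt (G x ^ 2 - v ^ 2)) volume a b :=
    fun a b => (hG.continuous_sqrt v).intervalIntegrable a b
  rw [← intervalIntegral.integral_add_adjacent_intervals (hi 0 (Ginv G (-v))) (hi _ X),
    left_eq_add, intervalIntegral.integral_congr (g := fun _ => 0), intervalIntegral.integral_zero]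
  intro x hx
  rw [uIcc_of_le hX] at hx
  exact hG.sqrt_eq_zero hv hx.1

theorem integral_Ginv_eq_Ioi (hG : IsImpulseProfile G) {v : ℝ} (hv : v ∈ Ioc 0 (-G 0)) :
    ∫ s in (0 : ℝ)..(Ginv G (-v)), Real.sqrt (G s ^ 2 - v ^ 2) =
      ∫ s in Ioi (0 : ℝ), Real.sqrt (G s ^ 2 - v ^ 2) := by
  have hy : -v ∈ Ico (G 0) 0 := ⟨by linarith [hv.2], by linarith [hv.1]⟩
  rw [intervalIntegral.integral_of_le (hG.Ginv_nonneg hy)]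
  refine (setIntegral_eq_of_subset_of_forall_sdiff_eq_zero measurableSet_Ioi
    Ioc_subset_Ioi_self fun x hx => ?_).symm
  refine hG.sqrt_eq_zero hv (le_of_not_ge fun h => hx.2 ⟨hx.1, h⟩)

/-- The integral defining `Ψ`, taken over the whole half-line, depends continuously on `v`. -/
theorem continuous_integral_Ioi (hG : IsImpulseProfile G) :
    Continuous fun v : ℝ => ∫ s in Ioi (0 : ℝ), Real.sqrt (G s ^ 2 - v ^ 2) := by
  refine continuous_of_dominated (bound := fun s => ‖G s‖)
    (fun v => (hG.continuous_sqrt v).aestronglyMeasurable)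
    (fun v => Eventually.of_forall fun s => ?_) hG.integrable.norm.integrableOn
    (Eventually.of_forall fun s => by fun_prop)
  rw [Real.norm_of_nonneg (Real.sqrt_nonneg _), Real.norm_eq_abs]
  exact Real.sqrt_le_iff.2 ⟨abs_nonneg _, by rw [sq_abs]; nlinarith [sq_nonneg v]⟩

end IsImpulseProfile
end SineGordon

/-! ### Two trigonometric integrals with a complex parameter. -/

namespace SineGordon

open MeasureTheory Complex

/-- The denominator factors as `(cos φ + iR sin φ)(cos φ - iR sin φ)`. Both factors stay in the slit
plane when `Re R > 0`, so a difference of principal logarithms is an antiderivative. -/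
theorem integral_inv_cos_sq_add_sin_sq {R : ℂ} (hR : 0 < R.re) :
    ∫ φ in (0 : ℝ)..(Real.pi / 2), (Complex.cos φ ^ 2 + R ^ 2 * Complex.sin φ ^ 2)⁻¹ =
      Real.pi / (2 * R) := by
  have hR0 : R ≠ 0 := fun h => by simp [h] at hR
  have hp : ∀ φ ∈ Icc (0 : ℝ) (Real.pi / 2),
      Complex.cos φ + I * R * Complex.sin φ ∈ slitPlane ∧
      Complex.cos φ - I * R * Complex.sin φ ∈ slitPlane := by
    intro φ hφ
    have e1 : (Complex.cos φ).re = Real.cos φ ∧ (Complex.cos φ).im = 0 ∧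
        (Complex.sin φ).re = Real.sin φ ∧ (Complex.sin φ).im = 0 := by
      simp [← ofReal_cos, ← ofReal_sin]
    rcases hφ.1.eq_or_lt with h | h
    · subst h; simp
    · have hs : 0 < Real.sin φ := Real.sin_pos_of_pos_of_lt_pi h (by linarith [hφ.2, Real.pi_pos])
      have := mul_pos hR hs
      constructor <;> refine Or.inr ?_ <;> simp [e1] <;> constructor <;> linarith
  have hd : ∀ φ ∈ uIcc (0 : ℝ) (Real.pi / 2), HasDerivAt
      (fun φ : ℝ => (Complex.log (Complex.cos φ + I * R * Complex.sin φ) -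
        Complex.log (Complex.cos φ - I * R * Complex.sin φ)) / (2 * I * R))
      ((Complex.cos φ ^ 2 + R ^ 2 * Complex.sin φ ^ 2)⁻¹) φ := by
    intro φ hφ
    rw [uIcc_of_le (by positivity)] at hφ
    obtain ⟨h1, h2⟩ := hp φ hφ
    have hc := (Complex.hasDerivAt_cos (φ : ℂ)).comp_ofReal
    have hs := (Complex.hasDerivAt_sin (φ : ℂ)).comp_ofReal
    have d1 := (hc.add (hs.const_mul (I * R))).clog_real h1
    have d2 := (hc.sub (hs.const_mul (I * R))).clog_real h2
    refine ((d1.sub d2).div_const (2 * I * R)).congr_deriv ?_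
    simp only [Pi.add_apply, Pi.sub_apply]
    have n1 := slitPlane_ne_zero h1
    have n2 := slitPlane_ne_zero h2
    have hI : (I : ℂ) ^ 2 = -1 := I_sq
    have e : Complex.cos φ ^ 2 + R ^ 2 * Complex.sin φ ^ 2 =
      (Complex.cos φ + I * R * Complex.sin φ) * (Complex.cos φ - I * R * Complex.sin φ) := by
      linear_combination (R ^ 2 * Complex.sin φ ^ 2) * hI
    rw [e]
    have hcs := Complex.sin_sq_add_cos_sq (φ : ℂ)
    have h2IR : 2 * I * R ≠ 0 := mul_ne_zero (mul_ne_zero two_ne_zero I_ne_zero) hR0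
    have key : (-Complex.sin φ + I * R * Complex.cos φ) *
        (Complex.cos φ - I * R * Complex.sin φ) -
        (Complex.cos φ + I * R * Complex.sin φ) *
        (-Complex.sin φ - I * R * Complex.cos φ) = 2 * I * R := by
      linear_combination (2 * I * R) * hcs
    rw [div_sub_div _ _ n1 n2, key, div_right_comm, div_self h2IR, one_div]
  rw [intervalIntegral.integral_eq_sub_of_hasDerivAt hd]
  -- With `|arg R| < π/2` the logarithms of `iR` and `-iR` incur no winding correction, and their
  -- difference is exactly `πi`.
  · have harg := abs_lt.1 (abs_arg_lt_pi_div_two_iff.2 (Or.inl hR))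
    have l1 : Complex.log (I * R) = Real.pi / 2 * I + Complex.log R := by
      rw [Complex.log_mul (by simp) hR0, Complex.log_I]
      simp only [arg_I, mem_Ioc]; constructor <;> linarith
    have l2 : Complex.log (-(I * R)) = -(Real.pi / 2 * I) + Complex.log R := by
      rw [← neg_mul, Complex.log_mul (by simp) hR0, Complex.log_neg_I]; ring
      simp only [arg_neg_I, mem_Ioc]; constructor <;> linarith
    have c1 : Complex.cos ((Real.pi / 2 : ℝ) : ℂ) = 0 := by rw [← ofReal_cos]; simp
    have c2 : Complex.sin ((Real.pi / 2 : ℝ) : ℂ) = 1 := by rw [← ofReal_sin]; simp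
    rw [c1, c2]
    simp only [zero_add, zero_sub, mul_one, l1, l2]
    simp
    field_simp
    ring
  · apply ContinuousOn.intervalIntegrable
    intro φ hφ
    rw [uIcc_of_le (by positivity)] at hφ
    obtain ⟨h1, h2⟩ := hp φ hφ
    refine ContinuousWithinAt.inv₀ (by fun_prop) ?_
    convert mul_ne_zero (slitPlane_ne_zero h1) (slitPlane_ne_zero h2) using 1
    have hI : (I : ℂ) ^ 2 = -1 := I_sq
    linear_combination (R ^ 2 * Complex.sin φ ^ 2) * hI

theorem cpow_half_sq (y : ℂ) : (y ^ (1 / 2 : ℂ)) ^ 2 = y := by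
  rw [one_div, cpow_ofNat_inv_pow]

theorem cpow_half_re_pos {y : ℂ} (hy : y ∈ slitPlane) : 0 < (y ^ (1 / 2 : ℂ)).re := by
  rw [one_div, cpow_inv_two_re, Real.sqrt_pos]
  have h := Complex.abs_re_le_norm y
  rcases hy with h1 | h1
  · linarith [norm_nonneg y]
  · have h2 : |y.re| < ‖y‖ := abs_re_lt_norm.2 h1
    linarith [neg_abs_le y.re]

theorem integral_cos_sq_div {ζ : ℂ} (hζ : 1 - ζ ∈ slitPlane) :
    ∫ φ in (0 : ℝ)..(Real.pi / 2), ζ * Complex.cos φ ^ 2 / (1 - ζ * Complex.sin φ ^ 2) =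
      Real.pi / 2 * (1 - (1 - ζ) ^ (1 / 2 : ℂ)) := by
  set R := (1 - ζ) ^ (1 / 2 : ℂ) with hRdef
  have hR : 0 < R.re := cpow_half_re_pos hζ
  have hR2 : R ^ 2 = 1 - ζ := cpow_half_sq _
  have hR0 : R ≠ 0 := fun h => by simp [h] at hR
  have hne : ∀ φ : ℝ, Complex.cos φ ^ 2 + R ^ 2 * Complex.sin φ ^ 2 ≠ 0 := by
    intro φ h
    have hcs := Complex.sin_sq_add_cos_sq (φ : ℂ)
    rw [← ofReal_sin, ← ofReal_cos] at h hcs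
    norm_cast at hcs
    have h3 : 1 - ζ * ((Real.sin φ ^ 2 : ℝ) : ℂ) = 0 := by
      rw [hR2] at h
      have : (Real.sin φ : ℂ) ^ 2 = 1 - (Real.cos φ : ℂ) ^ 2 := by
        norm_cast; linarith
      rw [ofReal_pow]
      linear_combination h - this
    have hs : Real.sin φ ^ 2 ≠ 0 := fun h0 => by simp [h0] at h3
    have hz : ζ = (((Real.sin φ ^ 2)⁻¹ : ℝ) : ℂ) := by
      rw [ofReal_inv]
      exact eq_inv_of_mul_eq_one_left (by linear_combination -h3)
    rw [hz, ← ofReal_one, ← ofReal_sub, ofReal_mem_slitPlane] at hζ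
    have h4 : 1 ≤ (Real.sin φ ^ 2)⁻¹ := (one_le_inv₀ (by positivity)).2 (Real.sin_sq_le_one φ)
    linarith
  have hcont : Continuous fun φ : ℝ => (Complex.cos φ ^ 2 + R ^ 2 * Complex.sin φ ^ 2)⁻¹ :=
    Continuous.inv₀ (by fun_prop) hne
  -- With `R² = 1 - ζ` the denominator becomes `cos² φ + R² sin² φ`, which reduces the integral to
  -- the preceding one.
  have heq : ∀ φ : ℝ, ζ * Complex.cos φ ^ 2 / (1 - ζ * Complex.sin φ ^ 2) =
      1 - R ^ 2 * (Complex.cos φ ^ 2 + R ^ 2 * Complex.sin φ ^ 2)⁻¹ := by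
    intro φ
    have hcs := Complex.sin_sq_add_cos_sq (φ : ℂ)
    have e : 1 - ζ * Complex.sin φ ^ 2 = Complex.cos φ ^ 2 + R ^ 2 * Complex.sin φ ^ 2 := by
      rw [hR2]; linear_combination -hcs
    have := hne φ
    rw [e]
    field_simp
    rw [hR2]
    linear_combination (ζ - 1) * hcs
  simp_rw [heq]
  rw [intervalIntegral.integral_sub (by simp)
    ((hcont.const_mul (R ^ 2)).intervalIntegrable _ _), intervalIntegral.integral_const_mul,
    integral_inv_cos_sq_add_sin_sq hR, intervalIntegral.integral_const]
  simp
  field_simp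

end SineGordon

/-! ### The Cauchy integral of a truncated semicircle density. -/

namespace SineGordon

open MeasureTheory

/-- The positive solution `σ` of `σ - σ⁻¹ = q`. -/
noncomputable def sig (q : ℝ) : ℝ := (q + Real.sqrt (q ^ 2 + 4)) / 2

theorem sig_pos (q : ℝ) : 0 < sig q := by
  have h : |q| < Real.sqrt (q ^ 2 + 4) := Real.lt_sqrt_of_sq_lt (by rw [sq_abs]; linarith)
  unfold sig
  linarith [neg_abs_le q]

theorem sig_mul_sig_neg (q : ℝ) : sig q * sig (-q) = 1 := by
  have h : Real.sqrt (q ^ 2 + 4) ^ 2 = q ^ 2 + 4 := Real.sq_sqrt (by positivity)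
  unfold sig
  rw [neg_sq]
  linear_combination h / 4

theorem sig_neg (q : ℝ) : sig (-q) = (sig q)⁻¹ :=
  eq_inv_of_mul_eq_one_right (sig_mul_sig_neg q)

theorem sig_sub_inv (q : ℝ) : sig q - (sig q)⁻¹ = q := by
  rw [← sig_neg, sig, sig, neg_sq]
  ring

theorem sig_add_inv (q : ℝ) : sig q + (sig q)⁻¹ = Real.sqrt (q ^ 2 + 4) := by
  rw [← sig_neg, sig, sig, neg_sq]
  ring

theorem hasDerivAt_sig (q : ℝ) : HasDerivAt sig (sig q / (sig q + (sig q)⁻¹)) q := by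
  have h0 : q ^ 2 + 4 ≠ 0 := by positivity
  have h1 := ((hasDerivAt_id q).add
    ((((hasDerivAt_id q).pow 2).add_const (4 : ℝ)).sqrt h0)).div_const 2
  refine h1.congr_deriv ?_
  have h2 : Real.sqrt (q ^ 2 + 4) ≠ 0 := by positivity
  rw [sig_add_inv, sig]
  simp
  field_simp
  ring

theorem continuous_sig : Continuous sig :=
  continuous_iff_continuousAt.2 fun q => (hasDerivAt_sig q).continuousAt

theorem sig_strictMono : StrictMono sig := by
  refine strictMono_of_deriv_pos fun q => ?_
  rw [(hasDerivAt_sig q).deriv]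
  have := sig_pos q
  positivity

theorem sub_inv_mono {a b : ℝ} (ha : 0 < a) (h : a ≤ b) : a - a⁻¹ ≤ b - b⁻¹ := by
  have := inv_anti₀ ha h
  linarith

/-- `p² = (r - r⁻¹)²` for `r² = -z`, written as a rational function of `z`. -/
noncomputable def psq (z : ℂ) : ℂ := -(z + 1) ^ 2 / z

theorem psq_im {z : ℂ} (hz : z ≠ 0) : (psq z).im = -z.im * (1 - (Complex.normSq z)⁻¹) := by
  have h : psq z = -z - 2 - z⁻¹ := by
    unfold psq; field_simp; ring
  rw [h]
  simp [Complex.inv_im]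
  ring

theorem one_sub_inv_normSq_pos {z : ℂ} (hz : 1 < ‖z‖) : 0 < 1 - (Complex.normSq z)⁻¹ := by
  have : 1 < Complex.normSq z := by
    rw [Complex.normSq_eq_norm_sq]; nlinarith
  linarith [inv_lt_one_of_one_lt₀ this]

theorem psq_im_ne {z : ℂ} (hz : z.im ≠ 0) (hz1 : 1 < ‖z‖) : (psq z).im ≠ 0 := by
  rw [psq_im (fun h => hz (by simp [h]))]
  exact mul_ne_zero (neg_ne_zero.2 hz) (one_sub_inv_normSq_pos hz1).ne'

theorem one_sub_sq_div_im (c : ℝ) (y : ℂ) :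
    (1 - (c : ℂ) ^ 2 / y).im = c ^ 2 * y.im / Complex.normSq y := by
  rw [← Complex.ofReal_pow, div_eq_mul_inv, Complex.sub_im, Complex.im_ofReal_mul, Complex.inv_im,
    Complex.one_im]
  ring

/-- Off the real axis and outside the unit disc `psq z` is not real, so this number is real only for
`c = 0`, when it equals `1`. The principal root therefore never meets its cut. -/
theorem one_sub_div_psq_mem {z : ℂ} (hz : z.im ≠ 0) (hz1 : 1 < ‖z‖) (c : ℝ) :
    1 - (c : ℂ) ^ 2 / psq z ∈ Complex.slitPlane := by
  rcases eq_or_ne c 0 with rfl | hc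
  · simp
  · have h := psq_im_ne hz hz1
    have h0 : psq z ≠ 0 := fun h0 => h (by simp [h0])
    refine Or.inr ?_
    rw [one_sub_sq_div_im]
    exact div_ne_zero (mul_ne_zero (pow_ne_zero _ hc) h) (Complex.normSq_eq_zero.not.2 h0)

theorem ofReal_sub_ne_zero {z : ℂ} (hz : z.im ≠ 0) (s : ℝ) : (s : ℂ) - z ≠ 0 := fun h => hz (by
  have := congrArg Complex.im h
  simpa using this)

theorem continuousOn_kernel (c : ℝ) {z : ℂ} (hz : z.im ≠ 0) :
    ContinuousOn (fun s : ℝ =>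
      (Real.sqrt (c ^ 2 - (Real.sqrt (-s) - (Real.sqrt (-s))⁻¹) ^ 2) : ℂ) /
        (Real.sqrt (-s) * (s - z))) (Iio 0) := by
  intro s hs
  have h0 : Real.sqrt (-s) ≠ 0 := (Real.sqrt_pos.2 (neg_pos.2 hs)).ne'
  have h1 : (Real.sqrt (-s) : ℂ) * (s - z) ≠ 0 :=
    mul_ne_zero (by exact_mod_cast h0) (ofReal_sub_ne_zero hz s)
  have hs1 : Continuous fun s : ℝ => Real.sqrt (-s) := by fun_prop
  have hs2 : ContinuousAt (fun s : ℝ => (Real.sqrt (-s))⁻¹) s := hs1.continuousAt.inv₀ h0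
  have hn : ContinuousAt (fun s : ℝ =>
    (Real.sqrt (c ^ 2 - (Real.sqrt (-s) - (Real.sqrt (-s))⁻¹) ^ 2) : ℂ)) s := by fun_prop
  have hd : ContinuousAt (fun s : ℝ => (Real.sqrt (-s) : ℂ) * (s - z)) s := by fun_prop
  exact (hn.div hd h1).continuousWithinAt

/-- Replacing `q` by `-q` inverts `σ`, that is, it sends `s = -σ²` to `1/s`. The sum of the two
contributions is rational in `q²` and `z`. -/
theorem kernel_add_kernel_neg {z : ℂ} {q σ a : ℝ} (hσ : 0 < σ) (hq : σ - σ⁻¹ = q)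
    (hz : z.im ≠ 0) :
    2 * (a : ℂ) * σ / ((σ + (σ : ℂ)⁻¹) * (σ ^ 2 + z)) +
      2 * (a : ℂ) * (σ : ℂ)⁻¹ / ((σ + (σ : ℂ)⁻¹) * ((σ : ℂ)⁻¹ ^ 2 + z)) =
    -2 * ((1 + z) / z) * (a / (psq z - q ^ 2)) := by
  have hz0 : z ≠ 0 := fun h => hz (by simp [h])
  have hσ0 : (σ : ℂ) ≠ 0 := by exact_mod_cast hσ.ne'
  have hV : (σ : ℂ) ^ 2 + 1 ≠ 0 := by
    have : σ ^ 2 + 1 ≠ 0 := by positivity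
    exact_mod_cast this
  have h1 : (σ : ℂ) ^ 2 + z ≠ 0 := fun h => hz (by
    have := congrArg Complex.im h
    simpa [← Complex.ofReal_pow] using this)
  have h2 : 1 + z * (σ : ℂ) ^ 2 ≠ 0 := fun h => hz (by
    have := congrArg Complex.im h
    simpa [← Complex.ofReal_pow, hσ.ne'] using this)
  have h3 : psq z - (q : ℂ) ^ 2 = -((σ : ℂ) ^ 2 + z) * (1 + z * (σ : ℂ) ^ 2) / (z * σ ^ 2) := by
    rw [← hq, psq]
    push_cast
    field_simp
    ring
  rw [h3]
  have h4 : 1 + (σ : ℂ) ^ 2 * z ≠ 0 := by rwa [mul_comm]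
  field_simp
  ring

/-- The substitution `√(-s) = sig (c sin φ)` turns the numerator into `c cos φ`. Adding the
contributions of `φ` and `-φ` leaves the integral of `integral_cos_sq_div` with `ζ = c² / psq z`. -/
theorem integral_kernel_aux {c : ℝ} (hc : 0 ≤ c) {z : ℂ} (hz : z.im ≠ 0) (hz1 : 1 < ‖z‖) :
    ∫ s in (-(sig c) ^ 2)..(-(sig (-c)) ^ 2),
      (Real.sqrt (c ^ 2 - (Real.sqrt (-s) - (Real.sqrt (-s))⁻¹) ^ 2) : ℂ) /
        (Real.sqrt (-s) * (s - z)) =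
    Real.pi * ((1 + z) / z) * (1 - (1 - (c : ℂ) ^ 2 / psq z) ^ (1 / 2 : ℂ)) := by
  set g : ℝ → ℂ := fun s =>
      (Real.sqrt (c ^ 2 - (Real.sqrt (-s) - (Real.sqrt (-s))⁻¹) ^ 2) : ℂ) /
        (Real.sqrt (-s) * (s - z)) with hg
  set f : ℝ → ℝ := fun φ => -(sig (c * Real.sin φ)) ^ 2 with hf
  set f' : ℝ → ℝ := fun φ => -(2 * sig (c * Real.sin φ) * (sig (c * Real.sin φ) /
    (sig (c * Real.sin φ) + (sig (c * Real.sin φ))⁻¹) * (c * Real.cos φ))) with hf'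
  have hff : ∀ φ, HasDerivAt f (f' φ) φ := by
    intro φ
    have h1 := (((hasDerivAt_sig (c * Real.sin φ)).comp φ
      ((Real.hasDerivAt_sin φ).const_mul c)).pow 2).neg
    refine h1.congr_deriv ?_
    simp [hf']
  have hf'c : Continuous f' := by
    have h1 : Continuous fun φ => sig (c * Real.sin φ) := continuous_sig.comp (by fun_prop)
    have h2 : Continuous fun φ => (sig (c * Real.sin φ))⁻¹ := h1.inv₀ fun φ => (sig_pos _).ne'
    have h3 : Continuous fun φ => sig (c * Real.sin φ) /
      (sig (c * Real.sin φ) + (sig (c * Real.sin φ))⁻¹) := h1.div (h1.add h2) fun φ => by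
        have := sig_pos (c * Real.sin φ)
        positivity
    fun_prop
  have hgc : ContinuousOn g (Iio 0) := continuousOn_kernel c hz
  have hsub := intervalIntegral.integral_deriv_smul_comp' (a := Real.pi / 2) (b := -(Real.pi / 2))
    (f := f) (f' := f') (g := g) (fun φ _ => hff φ) hf'c.continuousOn
    (hgc.mono (by
      rintro _ ⟨φ, _, rfl⟩
      have := sig_pos (c * Real.sin φ)
      simp only [hf, mem_Iio, Left.neg_neg_iff]
      positivity))
  have e1 : f (Real.pi / 2) = -(sig c) ^ 2 := by simp [hf]
  have e2 : f (-(Real.pi / 2)) = -(sig (-c)) ^ 2 := by simp [hf]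
  rw [e1, e2] at hsub
  rw [← hsub, intervalIntegral.integral_symm]
  set h : ℝ → ℂ := fun φ => 2 * ((c ^ 2 * Real.cos φ ^ 2 : ℝ) : ℂ) * sig (c * Real.sin φ) /
    ((sig (c * Real.sin φ) + (sig (c * Real.sin φ) : ℂ)⁻¹) * (sig (c * Real.sin φ) ^ 2 + z)) with hh
  have hsig2 : ∀ φ : ℝ, (sig (c * Real.sin φ) : ℂ) ^ 2 + z ≠ 0 := fun φ h => hz (by
    have := congrArg Complex.im h
    simpa [← Complex.ofReal_pow] using this)
  have hgf : ∀ φ ∈ uIcc (-(Real.pi / 2)) (Real.pi / 2), f' φ • (g ∘ f) φ = h φ := by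
    intro φ hφ
    rw [uIcc_of_le (by linarith [Real.pi_pos])] at hφ
    have hcos := Real.cos_nonneg_of_mem_Icc hφ
    have hσ := sig_pos (c * Real.sin φ)
    have hσ0 : (sig (c * Real.sin φ) : ℂ) ≠ 0 := by exact_mod_cast hσ.ne'
    have hq := sig_sub_inv (c * Real.sin φ)
    have hs2 := hsig2 φ
    simp only [hg, hf, hf', hh, Function.comp, neg_neg, Real.sqrt_sq hσ.le, hq]
    have hr : Real.sqrt (c ^ 2 - (c * Real.sin φ) ^ 2) = c * Real.cos φ := by
      rw [show c ^ 2 - (c * Real.sin φ) ^ 2 = (c * Real.cos φ) ^ 2 by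
        linear_combination (-c ^ 2) * Real.sin_sq_add_cos_sq φ, Real.sqrt_sq (mul_nonneg hc hcos)]
    rw [hr, Complex.real_smul]
    have hV : (sig (c * Real.sin φ) : ℂ) ^ 2 + 1 ≠ 0 := by
      have : sig (c * Real.sin φ) ^ 2 + 1 ≠ 0 := by positivity
      exact_mod_cast this
    have hs3 : -(sig (c * Real.sin φ) : ℂ) ^ 2 - z ≠ 0 := fun h => hs2 (by linear_combination -h)
    push_cast
    generalize (sig (c * Real.sin φ) : ℂ) = σ at *
    field_simp
    ring
  rw [intervalIntegral.integral_congr hgf]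
  have hhc : Continuous h := by
    have h1 : Continuous fun φ => (sig (c * Real.sin φ) : ℂ) :=
      Complex.continuous_ofReal.comp (continuous_sig.comp (by fun_prop))
    have h2 : Continuous fun φ => (sig (c * Real.sin φ) : ℂ)⁻¹ := h1.inv₀ fun φ => by
      exact_mod_cast (sig_pos _).ne'
    refine Continuous.div (by fun_prop) (by fun_prop) fun φ => mul_ne_zero ?_ (hsig2 φ)
    have := sig_pos (c * Real.sin φ)
    have : sig (c * Real.sin φ) + (sig (c * Real.sin φ))⁻¹ ≠ 0 := by positivity
    exact_mod_cast this
  have hhi : ∀ a b, IntervalIntegrable h volume a b := fun a b => hhc.intervalIntegrable a b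
  rw [← intervalIntegral.integral_add_adjacent_intervals (hhi _ 0) (hhi 0 _)]
  have hneg : ∫ φ in (-(Real.pi / 2))..0, h φ = ∫ φ in (0 : ℝ)..(Real.pi / 2), h (-φ) := by
    rw [intervalIntegral.integral_comp_neg]; simp
  rw [hneg, ← intervalIntegral.integral_add (f := fun φ => h (-φ))
    ((hhc.comp continuous_neg).intervalIntegrable _ _) (hhi _ _)]
  have hP0 : psq z ≠ 0 := fun h0 => psq_im_ne hz hz1 (by simp [h0])
  have hsum : ∀ φ : ℝ, h (-φ) + h φ = -2 * ((1 + z) / z) *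
      (((c : ℂ) ^ 2 / psq z) * Complex.cos φ ^ 2 /
        (1 - ((c : ℂ) ^ 2 / psq z) * Complex.sin φ ^ 2)) := by
    intro φ
    have := kernel_add_kernel_neg (a := c ^ 2 * Real.cos φ ^ 2) (sig_pos (c * Real.sin φ))
      (sig_sub_inv (c * Real.sin φ)) hz
    have hn : h (-φ) = 2 * ((c ^ 2 * Real.cos φ ^ 2 : ℝ) : ℂ) * (sig (c * Real.sin φ) : ℂ)⁻¹ /
        ((sig (c * Real.sin φ) + (sig (c * Real.sin φ) : ℂ)⁻¹) *
          ((sig (c * Real.sin φ) : ℂ)⁻¹ ^ 2 + z)) := by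
      simp only [hh, Real.sin_neg, Real.cos_neg, mul_neg, sig_neg, Complex.ofReal_inv, inv_inv]
      rw [add_comm (sig (c * Real.sin φ) : ℂ)⁻¹]
    rw [hn, add_comm, this]
    congr 1
    have e : psq z - ((c * Real.sin φ : ℝ) : ℂ) ^ 2 =
        psq z * (1 - ((c : ℂ) ^ 2 / psq z) * Complex.sin φ ^ 2) := by
      push_cast
      field_simp
    rw [e]
    push_cast
    rw [← div_div]
    congr 1
    ring
  simp_rw [hsum]
  rw [intervalIntegral.integral_const_mul, integral_cos_sq_div (one_sub_div_psq_mem hz hz1 c)]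
  ring

theorem integral_kernel {c q : ℝ} (hc : 0 ≤ c) (hcq : c ≤ q) {z : ℂ} (hz : z.im ≠ 0)
    (hz1 : 1 < ‖z‖) :
    ∫ s in (-(sig q) ^ 2)..(-(sig (-q)) ^ 2),
      (Real.sqrt (c ^ 2 - (Real.sqrt (-s) - (Real.sqrt (-s))⁻¹) ^ 2) : ℂ) /
        (Real.sqrt (-s) * (s - z)) =
    Real.pi * ((1 + z) / z) * (1 - (1 - (c : ℂ) ^ 2 / psq z) ^ (1 / 2 : ℂ)) := by
  rw [← integral_kernel_aux hc hz hz1]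
  have hi : ∀ u v, IntervalIntegrable (fun s : ℝ =>
      (Real.sqrt (c ^ 2 - (Real.sqrt (-s) - (Real.sqrt (-s))⁻¹) ^ 2) : ℂ) /
        (Real.sqrt (-s) * (s - z))) volume (-(sig u) ^ 2) (-(sig v) ^ 2) := fun u v =>
    ((continuousOn_kernel c hz).mono fun s hs => by
      have hu := sig_pos u
      have hv := sig_pos v
      refine hs.2.trans_lt (max_lt ?_ ?_) <;> rw [neg_lt_zero] <;> positivity).intervalIntegrable
  -- On the parts of the larger interval with `|√(-s) - (√(-s))⁻¹| ≥ c` the truncated root vanishes.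
  -- All `c ≤ q` can thus share one interval, as Fubini requires.
  have hzero : ∀ {u v : ℝ}, u ≤ v → (∀ y ∈ Icc u v, c ^ 2 ≤ y ^ 2) →
      ∫ s in (-(sig v) ^ 2)..(-(sig u) ^ 2),
      (Real.sqrt (c ^ 2 - (Real.sqrt (-s) - (Real.sqrt (-s))⁻¹) ^ 2) : ℂ) /
        (Real.sqrt (-s) * (s - z)) = 0 := by
    intro u v huv h
    have hu := sig_pos u
    have huv' := sig_strictMono.monotone huv
    rw [intervalIntegral.integral_congr (g := fun _ => 0), intervalIntegral.integral_zero]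
    intro s hs
    rw [uIcc_of_le (by nlinarith)] at hs
    have h1 : sig u ≤ Real.sqrt (-s) := Real.le_sqrt_of_sq_le (by linarith [hs.2])
    have h2 : Real.sqrt (-s) ≤ sig v := Real.sqrt_le_iff.2 ⟨hu.le.trans huv', by linarith [hs.1]⟩
    have h3 := sub_inv_mono hu h1
    have h4 := sub_inv_mono (hu.trans_le h1) h2
    rw [sig_sub_inv] at h3 h4
    have := h _ ⟨h3, h4⟩
    simp only
    rw [Real.sqrt_eq_zero_of_nonpos (by linarith)]
    simp
  rw [← intervalIntegral.integral_add_adjacent_intervals (hi q c) (hi c (-q)),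
    ← intervalIntegral.integral_add_adjacent_intervals (hi c (-c)) (hi (-c) (-q)),
    hzero hcq fun y hy => by nlinarith [hy.1],
    hzero (neg_le_neg hcq) fun y hy => by nlinarith [hy.2]]
  ring
end SineGordon

/-! ### `theta0` on the real segment and its Cauchy integral. -/

namespace SineGordon

open MeasureTheory

variable {G : ℝ → ℝ}

theorem rt_ofReal {s : ℝ} (hs : s ≤ 0) : rt (s : ℂ) = Real.sqrt (-s) := by
  rw [rt, Real.sqrt_eq_rpow, Complex.ofReal_cpow (by linarith)]
  simp

theorem four_mul_E_im_ofReal {s : ℝ} (hs : s ≤ 0) :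
    4 * (E (s : ℂ)).im = Real.sqrt (-s) + (Real.sqrt (-s))⁻¹ := by
  have : E (s : ℂ) = ((Real.sqrt (-s) + (Real.sqrt (-s))⁻¹) / 4 : ℝ) * Complex.I := by
    rw [E, rt_ofReal hs]
    push_cast
    ring
  rw [this]
  simp
  ring

/-- The value at `𝔞` of `(-s)^{1/2} - (-s)^{-1/2}`. -/
noncomputable def qmax (G : ℝ → ℝ) : ℝ := Real.sqrt (G 0 ^ 2 - 4)

/-- The function `√(G(x)² - 4)` on `[0, x_crit]`. -/
noncomputable def cfun (G : ℝ → ℝ) (x : ℝ) : ℝ := Real.sqrt (G x ^ 2 - 4)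

namespace IsImpulseProfile

theorem qmax_sq (hG : IsImpulseProfile G) : qmax G ^ 2 = G 0 ^ 2 - 4 :=
  Real.sq_sqrt (by nlinarith [hG.kinks])

theorem qmax_pos (hG : IsImpulseProfile G) : 0 < qmax G :=
  Real.sqrt_pos.2 (by nlinarith [hG.kinks])

theorem sqrt_qmax (hG : IsImpulseProfile G) : Real.sqrt (qmax G ^ 2 + 4) = -G 0 := by
  rw [hG.qmax_sq, sub_add_cancel, Real.sqrt_sq_eq_abs, abs_of_nonpos (hG.nonpos 0)]

theorem endA_eq (hG : IsImpulseProfile G) : endA G = -(sig (qmax G)) ^ 2 := by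
  rw [sig, hG.sqrt_qmax, endA, qmax]
  ring

theorem endB_eq (hG : IsImpulseProfile G) : endB G = -(sig (-qmax G)) ^ 2 := by
  rw [sig, neg_sq, hG.sqrt_qmax, endB, qmax]
  ring

theorem endB_neg (hG : IsImpulseProfile G) : endB G < 0 := by
  rw [hG.endB_eq, neg_lt_zero]
  exact pow_pos (sig_pos _) 2

theorem sig_zero : sig 0 = 1 := by
  have : Real.sqrt 4 = 2 := by rw [show (4 : ℝ) = 2 ^ 2 by norm_num, Real.sqrt_sq (by norm_num)]
  simp [sig, this]

theorem endA_lt (hG : IsImpulseProfile G) : endA G < -1 := by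
  have h : sig 0 < sig (qmax G) := sig_strictMono hG.qmax_pos
  rw [sig_zero] at h
  rw [hG.endA_eq]
  nlinarith

theorem lt_endB (hG : IsImpulseProfile G) : -1 < endB G := by
  have h : sig (-qmax G) < sig 0 := sig_strictMono (neg_lt_zero.2 hG.qmax_pos)
  rw [sig_zero] at h
  rw [hG.endB_eq]
  nlinarith [sig_pos (-qmax G)]

theorem abs_sub_inv_le (hG : IsImpulseProfile G) {s : ℝ} (hs : s ∈ Icc (endA G) (endB G)) :
    (Real.sqrt (-s) - (Real.sqrt (-s))⁻¹) ^ 2 ≤ qmax G ^ 2 := by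
  rw [hG.endA_eq, hG.endB_eq] at hs
  have hu := sig_pos (-qmax G)
  have h1 : sig (-qmax G) ≤ Real.sqrt (-s) := Real.le_sqrt_of_sq_le (by linarith [hs.2])
  have h2 : Real.sqrt (-s) ≤ sig (qmax G) :=
    Real.sqrt_le_iff.2 ⟨(sig_pos _).le, by linarith [hs.1]⟩
  have h3 := sub_inv_mono hu h1
  have h4 := sub_inv_mono (hu.trans_le h1) h2
  rw [sig_sub_inv] at h3 h4
  exact sq_le_sq' h3 h4

theorem add_inv_mem (hG : IsImpulseProfile G) {s : ℝ} (hs : s ∈ Icc (endA G) (endB G)) :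
    Real.sqrt (-s) + (Real.sqrt (-s))⁻¹ ∈ Icc 2 (-G 0) := by
  have h0 : 0 < Real.sqrt (-s) := Real.sqrt_pos.2 (by linarith [hs.2, hG.endB_neg])
  have h1 := hG.abs_sub_inv_le hs
  rw [hG.qmax_sq] at h1
  have h2 : Real.sqrt (-s) * (Real.sqrt (-s))⁻¹ = 1 := mul_inv_cancel₀ h0.ne'
  have h3 : 0 < (Real.sqrt (-s))⁻¹ := inv_pos.2 h0
  constructor
  · nlinarith [sq_nonneg (Real.sqrt (-s) - (Real.sqrt (-s))⁻¹)]
  · refine abs_le_of_sq_le_sq' ?_ (by linarith [hG.nonpos 0]) |>.2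
    nlinarith

theorem theta0_eq (hG : IsImpulseProfile G) {w : ℂ} (hw : 4 * (E w).im ∈ Ioc 0 (-G 0)) :
    theta0 G w = (1 / 2 * ∫ s in Ioi (0 : ℝ), Real.sqrt (G s ^ 2 - (4 * (E w).im) ^ 2) : ℝ) := by
  rw [theta0, Psi, hG.integral_Ginv_eq_Ioi hw]

theorem cfun_sq (hG : IsImpulseProfile G) {x : ℝ} (hx : x ∈ Icc 0 (xcrit G)) :
    cfun G x ^ 2 = G x ^ 2 - 4 :=
  Real.sq_sqrt (by nlinarith [hG.le_neg_two hx])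

theorem continuous_cfun (hG : IsImpulseProfile G) : Continuous (cfun G) :=
  ((hG.continuous.pow 2).sub continuous_const).sqrt

theorem cfun_le (hG : IsImpulseProfile G) {x : ℝ} (hx : 0 ≤ x) : cfun G x ≤ qmax G :=
  Real.sqrt_le_sqrt (by nlinarith [hG.apply_zero_le hx, hG.nonpos x])

/-- On the segment `v = r + r⁻¹ ≥ 2`, so the turning point lies in `[0, x_crit]`; and `(r + r⁻¹)² =
(r - r⁻¹)² + 4` trades `G` for `cfun`. -/
theorem theta0_ofReal (hG : IsImpulseProfile G) {s : ℝ} (hs : s ∈ Icc (endA G) (endB G)) :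
    theta0 G s = (1 / 2 * ∫ x in (0 : ℝ)..(xcrit G),
      Real.sqrt (cfun G x ^ 2 - (Real.sqrt (-s) - (Real.sqrt (-s))⁻¹) ^ 2) : ℝ) := by
  have hs0 : s < 0 := hs.2.trans_lt hG.endB_neg
  have hv := hG.add_inv_mem hs
  have h2 : Real.sqrt (-s) * (Real.sqrt (-s))⁻¹ = 1 :=
    mul_inv_cancel₀ (Real.sqrt_pos.2 (by linarith)).ne'
  have hle : Ginv G (-(Real.sqrt (-s) + (Real.sqrt (-s))⁻¹)) ≤ xcrit G := by
    have hy : -(Real.sqrt (-s) + (Real.sqrt (-s))⁻¹) ∈ Ico (G 0) 0 :=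
      ⟨by linarith [hv.2], by linarith [hv.1]⟩
    rw [← hG.strictMonoOn.le_iff_le (hG.Ginv_nonneg hy) hG.xcrit_nonneg, hG.apply_Ginv hy,
      hG.apply_xcrit]
    linarith [hv.1]
  rw [theta0, Psi, four_mul_E_im_ofReal hs0.le,
    hG.integral_Ginv_eq ⟨by linarith [hv.1], hv.2⟩ hle]
  congr 2
  refine intervalIntegral.integral_congr fun x hx => ?_
  rw [uIcc_of_le hG.xcrit_nonneg] at hx
  rw [hG.cfun_sq hx]
  congr 1
  linear_combination -4 * h2

theorem continuousOn_theta0_ofReal (hG : IsImpulseProfile G) :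
    ContinuousOn (fun s : ℝ => theta0 G s) (Icc (endA G) (endB G)) := by
  have h1 : ContinuousOn (fun s : ℝ => ((1 / 2 * ∫ x in Ioi (0 : ℝ),
      Real.sqrt (G x ^ 2 - (Real.sqrt (-s) + (Real.sqrt (-s))⁻¹) ^ 2) : ℝ) : ℂ))
      (Icc (endA G) (endB G)) := by
    refine Complex.continuous_ofReal.comp_continuousOn (ContinuousOn.mul continuousOn_const
      (hG.continuous_integral_Ioi.comp_continuousOn ?_))
    have hs1 : Continuous fun s : ℝ => Real.sqrt (-s) := by fun_prop
    exact hs1.continuousOn.add (hs1.continuousOn.inv₀ fun s hs =>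
      (Real.sqrt_pos.2 (by linarith [hs.2, hG.endB_neg])).ne')
  refine h1.congr fun s hs => ?_
  have hv := hG.add_inv_mem hs
  have hs0 : s < 0 := hs.2.trans_lt hG.endB_neg
  have h2 := four_mul_E_im_ofReal hs0.le
  simp only
  rw [hG.theta0_eq (by rw [h2]; exact ⟨by linarith [hv.1], hv.2⟩), h2]

theorem continuousOn_theta0_div_rt (hG : IsImpulseProfile G) :
    ContinuousOn (fun s : ℝ => theta0 G s / rt s) (Icc (endA G) (endB G)) := by
  have hs1 : Continuous fun s : ℝ => (Real.sqrt (-s) : ℂ) := by fun_prop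
  refine (hG.continuousOn_theta0_ofReal.div hs1.continuousOn fun s hs => ?_).congr fun s hs => ?_
  · exact_mod_cast (Real.sqrt_pos.2 (by linarith [hs.2, hG.endB_neg])).ne'
  · rw [rt_ofReal (by linarith [hs.2, hG.endB_neg])]
    rfl

/-- After exchanging the two integrations, the inner one is `integral_kernel` with `c = cfun G x`,
and `cfun G x ≤ qmax G` holds for every `x` involved. -/
theorem integral_theta0 (hG : IsImpulseProfile G) {z : ℂ} (hz : z.im ≠ 0) (hz1 : 1 < ‖z‖) :
    ∫ s in (endA G)..(endB G), theta0 G s / rt s / (s - z) =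
      Real.pi / 2 * ((1 + z) / z) * ∫ x in (0 : ℝ)..(xcrit G),
        (1 - (1 - (cfun G x : ℂ) ^ 2 / psq z) ^ (1 / 2 : ℂ)) := by
  have hab : endA G ≤ endB G := by linarith [hG.endA_lt, hG.lt_endB]
  set F : ℝ → ℝ → ℂ := fun s x =>
    (Real.sqrt (cfun G x ^ 2 - (Real.sqrt (-s) - (Real.sqrt (-s))⁻¹) ^ 2) : ℂ) /
        (Real.sqrt (-s) * (s - z)) with hF
  have h1 : ∀ s ∈ uIcc (endA G) (endB G), theta0 G s / rt s / (s - z) =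
      1 / 2 * ∫ x in (0 : ℝ)..(xcrit G), F s x := by
    intro s hs
    rw [uIcc_of_le hab] at hs
    rw [hG.theta0_ofReal hs, rt_ofReal (by linarith [hs.2, hG.endB_neg]), div_div]
    simp only [hF]
    rw [intervalIntegral.integral_div, intervalIntegral.integral_ofReal]
    push_cast
    ring
  rw [intervalIntegral.integral_congr h1, intervalIntegral.integral_const_mul,
    intervalIntegral_intervalIntegral_swap]
  · have h2 : ∀ x ∈ uIcc 0 (xcrit G), ∫ s in (endA G)..(endB G), F s x =
        Real.pi * ((1 + z) / z) * (1 - (1 - (cfun G x : ℂ) ^ 2 / psq z) ^ (1 / 2 : ℂ)) := by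
      intro x hx
      rw [uIcc_of_le hG.xcrit_nonneg] at hx
      rw [hG.endA_eq, hG.endB_eq]
      exact integral_kernel (Real.sqrt_nonneg _) (hG.cfun_le hx.1) hz hz1
    rw [intervalIntegral.integral_congr h2, intervalIntegral.integral_const_mul]
    ring
  · have hcont : ContinuousOn (Function.uncurry F)
        (uIcc (endA G) (endB G) ×ˢ uIcc 0 (xcrit G)) := by
      rintro ⟨s, x⟩ ⟨hs, _⟩
      rw [uIcc_of_le hab] at hs
      have h0 : Real.sqrt (-s) ≠ 0 := (Real.sqrt_pos.2 (by linarith [hs.2, hG.endB_neg])).ne'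
      have h1 : (Real.sqrt (-s) : ℂ) * (s - z) ≠ 0 :=
        mul_ne_zero (by exact_mod_cast h0) (ofReal_sub_ne_zero hz s)
      have hs1 : Continuous fun y : ℝ × ℝ => Real.sqrt (-y.1) := by fun_prop
      have hs2 : ContinuousAt (fun y : ℝ × ℝ => (Real.sqrt (-y.1))⁻¹) (s, x) :=
        hs1.continuousAt.inv₀ h0
      have hcc := hG.continuous_cfun
      have hn : ContinuousAt (fun y : ℝ × ℝ => (Real.sqrt (cfun G y.2 ^ 2 -
        (Real.sqrt (-y.1) - (Real.sqrt (-y.1))⁻¹) ^ 2) : ℂ)) (s, x) := by fun_prop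
      have hd : ContinuousAt (fun y : ℝ × ℝ => (Real.sqrt (-y.1) : ℂ) * (y.1 - z)) (s, x) := by
        fun_prop
      exact (hn.div hd h1).continuousWithinAt
    have hint : IntegrableOn (Function.uncurry F)
        (uIcc (endA G) (endB G) ×ˢ uIcc 0 (xcrit G)) :=
      hcont.integrableOn_compact (isCompact_uIcc.prod isCompact_uIcc)

    exact hint.mono_set (prod_mono uIoc_subset_uIcc uIoc_subset_uIcc)

end IsImpulseProfile
end SineGordon

/-! ### Splitting `L` and `𝔤` into segment, inner and circular parts. -/

namespace SineGordon

open MeasureTheory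

variable {G : ℝ → ℝ}

/-- Off the compact path the Cauchy kernel is bounded uniformly for nearby `z`, by `2/δ` with `δ`
the distance from `w` to the path; dominated convergence applies. -/
theorem continuousAt_integral_div_sub {F y : ℝ → ℂ} {α β : ℝ} {w : ℂ}
    (hF : IntervalIntegrable F volume α β) (hy : Continuous y)
    (hw : ∀ φ ∈ uIcc α β, y φ ≠ w) :
    ContinuousAt (fun z => ∫ φ in α..β, F φ / (y φ - z)) w := by
  obtain ⟨φ₀, hφ₀, hmin⟩ := isCompact_uIcc.exists_isMinOn (nonempty_uIcc (a := α) (b := β))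
    (f := fun φ => ‖y φ - w‖) (by fun_prop)
  set δ := ‖y φ₀ - w‖ with hδ
  have hδ0 : 0 < δ := norm_pos_iff.2 (sub_ne_zero.2 (hw φ₀ hφ₀))
  have hlow : ∀ z ∈ Metric.ball w (δ / 2), ∀ φ ∈ uIcc α β, δ / 2 ≤ ‖y φ - z‖ := by
    intro z hz φ hφ
    have h1 : δ ≤ ‖y φ - w‖ := hmin hφ
    have h2 : ‖z - w‖ < δ / 2 := mem_ball_iff_norm.1 hz
    have h3 : ‖y φ - w‖ ≤ ‖y φ - z‖ + ‖z - w‖ := norm_sub_le_norm_sub_add_norm_sub _ _ _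
    linarith
  refine intervalIntegral.continuousAt_of_dominated_interval
    (bound := fun φ => ‖F φ‖ * (δ / 2)⁻¹) ?_ ?_ (hF.norm.mul_const _) ?_
  · refine Eventually.of_forall fun z => ?_
    have h := hF.aestronglyMeasurable_restrict_uIoc
    have h2 : AEStronglyMeasurable (fun φ => (y φ - z)⁻¹) (volume.restrict (uIoc α β)) :=
      (hy.measurable.sub_const z).inv.aestronglyMeasurable
    simpa only [div_eq_mul_inv] using! h.mul h2
  · filter_upwards [Metric.ball_mem_nhds w (half_pos hδ0)] with z hz
    refine Eventually.of_forall fun φ hφ => ?_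
    rw [norm_div, div_eq_mul_inv]
    gcongr
    exact hlow z hz φ (uIoc_subset_uIcc hφ)
  · refine Eventually.of_forall fun φ hφ => ?_
    have h0 : y φ - w ≠ 0 := sub_ne_zero.2 (hw φ (uIoc_subset_uIcc hφ))
    exact continuousAt_const.div (by fun_prop) h0

/-- The density of the Cauchy integral over the unit circle. -/
noncomputable def circleDensity (G : ℝ → ℝ) (φ : ℝ) : ℂ :=
  theta0 G (Complex.exp (φ * Complex.I)) / rt (Complex.exp (φ * Complex.I)) *
    (Complex.I * Complex.exp (φ * Complex.I))

theorem norm_rt (w : ℂ) : ‖rt w‖ ^ 2 = ‖w‖ := by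
  rw [← norm_pow, rt, cpow_half_sq, norm_neg]

theorem rt_sq (w : ℂ) : rt w ^ 2 = -w := cpow_half_sq _

/-- On the unit circle the inverse of `rt w` is its conjugate. -/
theorem four_mul_E_im_of_norm {w : ℂ} (hw : ‖w‖ = 1) : 4 * (E w).im = 2 * (rt w).re := by
  have h1 : ‖rt w‖ = 1 := by
    have := norm_rt w
    rw [hw] at this
    exact (pow_eq_one_iff_of_nonneg (norm_nonneg _) two_ne_zero).1 this
  have h2 : (rt w)⁻¹ = (starRingEnd ℂ) (rt w) := Complex.inv_eq_conj h1
  rw [E, h2, Complex.add_conj]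
  have : Complex.I / 4 * ((2 * (rt w).re : ℝ) : ℂ) = ((2 * (rt w).re / 4 : ℝ) : ℂ) * Complex.I := by
    push_cast
    ring
  rw [this]
  simp
  ring

theorem four_mul_E_im_mem {w : ℂ} (hw : ‖w‖ = 1) (hw1 : w ≠ 1) : 4 * (E w).im ∈ Ioc 0 2 := by
  rw [four_mul_E_im_of_norm hw]
  have hs : -w ∈ Complex.slitPlane := by
    by_contra h
    rw [Complex.mem_slitPlane_iff_not_le_zero, not_not, Complex.le_def] at h
    have him : w.im = 0 := by simpa using h.2
    have hre : 0 ≤ w.re := by simpa using h.1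
    apply hw1
    have h3 : w = (w.re : ℂ) := by apply Complex.ext <;> simp [him]
    rw [h3, Complex.norm_real, Real.norm_of_nonneg hre] at hw
    rw [h3, hw, Complex.ofReal_one]
  have h1 : 0 < (rt w).re := cpow_half_re_pos hs
  have h2 : ‖rt w‖ = 1 := by
    have := norm_rt w
    rw [hw] at this
    exact (pow_eq_one_iff_of_nonneg (norm_nonneg _) two_ne_zero).1 this
  have h3 := Complex.re_le_norm (rt w)
  exact ⟨by linarith, by linarith⟩

theorem ae_exp_ne_one : ∀ᵐ φ : ℝ, Complex.exp (φ * Complex.I) ≠ 1 := by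
  have hsub : {φ : ℝ | Complex.exp (φ * Complex.I) = 1} ⊆ range fun n : ℤ => n * (2 * Real.pi) := by
    intro φ hφ
    obtain ⟨n, hn⟩ := Complex.exp_eq_one_iff.1 hφ
    refine ⟨n, ?_⟩
    rw [← mul_assoc (n : ℂ)] at hn
    rw [← mul_assoc, mul_comm _ Complex.I, mul_comm _ Complex.I] at hn
    have := mul_left_cancel₀ Complex.I_ne_zero hn
    rw [mul_assoc] at this
    exact_mod_cast this.symm
  have h0 := ((countable_range fun n : ℤ => (n : ℝ) * (2 * Real.pi)).mono hsub).measure_zero volume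
  rw [ae_iff]
  simpa using h0

theorem measurable_rt : Measurable rt := by
  unfold rt
  fun_prop

theorem measurable_E : Measurable E := by
  have := measurable_rt
  unfold E
  fun_prop

/-- Away from the null set where the exponential equals `1`, the argument of `Psi` lies in `(0, 2]`,
where the half-line form of `Psi` is continuous and bounded. Integrability is all that is needed,
because the circular part is only evaluated off the circle. -/
theorem IsImpulseProfile.intervalIntegrable_circleDensity (hG : IsImpulseProfile G) (a b : ℝ) :
    IntervalIntegrable (circleDensity G) volume a b := by
  set Φ : ℝ → ℝ := fun v => 1 / 2 * ∫ s in Ioi (0 : ℝ), Real.sqrt (G s ^ 2 - v ^ 2) with hΦ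
  have hΦc : Continuous Φ := continuous_const.mul hG.continuous_integral_Ioi
  obtain ⟨C, hC⟩ := isCompact_Icc.exists_bound_of_continuousOn (s := Icc (0 : ℝ) 2)
    hΦc.continuousOn
  set e : ℝ → ℂ := fun φ => Complex.exp (φ * Complex.I) with he
  have hem : Measurable e := by fun_prop
  have hnorm : ∀ φ, ‖e φ‖ = 1 := fun φ => Complex.norm_exp_ofReal_mul_I φ
  have heq : ∀ φ, e φ ≠ 1 → circleDensity G φ =
      (Φ (4 * (E (e φ)).im) : ℂ) / rt (e φ) * (Complex.I * e φ) := by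
    intro φ hφ
    have hv := four_mul_E_im_mem (hnorm φ) hφ
    rw [circleDensity, hG.theta0_eq ⟨hv.1, by linarith [hv.2, hG.kinks]⟩]
  have hmeas : AEStronglyMeasurable (circleDensity G) volume := by
    have hm : Measurable fun φ => (Φ (4 * (E (e φ)).im) : ℂ) / rt (e φ) * (Complex.I * e φ) := by
      have h1 := measurable_rt
      have h2 := measurable_E
      have h3 := hΦc.measurable
      have h4 : Measurable fun φ => 4 * (E (e φ)).im :=
        (Complex.measurable_im.comp (h2.comp hem)).const_mul 4
      exact ((Complex.measurable_ofReal.comp (h3.comp h4)).div (h1.comp hem)).mul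
        (hem.const_mul Complex.I)
    refine hm.aestronglyMeasurable.congr ?_
    filter_upwards [ae_exp_ne_one] with φ hφ
    exact (heq φ hφ).symm
  rw [intervalIntegrable_iff]
  refine Measure.integrableOn_of_bounded (M := C) (by simp [uIoc]) hmeas
    (ae_restrict_of_ae ?_)
  filter_upwards [ae_exp_ne_one] with φ hφ
  have hv := four_mul_E_im_mem (hnorm φ) hφ
  have h2 : ‖rt (e φ)‖ = 1 := by
    have := norm_rt (e φ)
    rw [hnorm] at this
    exact (pow_eq_one_iff_of_nonneg (norm_nonneg _) two_ne_zero).1 this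
  rw [heq φ hφ, norm_mul, norm_div, norm_mul, h2, hnorm, Complex.norm_I, Complex.norm_real]
  simpa using hC _ (Ioc_subset_Icc_self hv)

/-- The circular part of the Cauchy integral. -/
noncomputable def circlePart (G : ℝ → ℝ) (z : ℂ) : ℂ :=
  (∫ φ in Real.pi..0, circleDensity G φ / (Complex.exp (φ * Complex.I) - z)) +
    ∫ φ in (-Real.pi)..0, circleDensity G φ / (Complex.exp (φ * Complex.I) - z)

/-- The part of the Cauchy integral coming from `(-1, 𝔟)`. -/
noncomputable def innerPart (G : ℝ → ℝ) (z : ℂ) : ℂ :=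
  ∫ s in (-1)..(endB G), theta0 G s / rt s / (s - z)

/-- The Cauchy integral over the whole segment `[𝔞, 𝔟]`. -/
noncomputable def segPart (G : ℝ → ℝ) (z : ℂ) : ℂ :=
  ∫ s in (endA G)..(endB G), theta0 G s / rt s / (s - z)

theorem IsImpulseProfile.continuousAt_circlePart (hG : IsImpulseProfile G) {w : ℂ}
    (hw : ‖w‖ ≠ 1) : ContinuousAt (circlePart G) w := by
  have h : ∀ a b, ContinuousAt
      (fun z => ∫ φ in a..b, circleDensity G φ / (Complex.exp (φ * Complex.I) - z)) w :=
    fun a b => continuousAt_integral_div_sub (hG.intervalIntegrable_circleDensity a b)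
      (by fun_prop) fun φ _ he => hw (he ▸ Complex.norm_exp_ofReal_mul_I φ)
  exact (h _ _).add (h _ _)

theorem IsImpulseProfile.continuousAt_innerPart (hG : IsImpulseProfile G) {w : ℝ}
    (hw : w < -1) : ContinuousAt (innerPart G) (w : ℂ) := by
  refine continuousAt_integral_div_sub (F := fun s : ℝ => theta0 G s / rt s)
    (y := fun s : ℝ => (s : ℂ)) ?_ (by fun_prop) fun s hs h => ?_
  · refine (hG.continuousOn_theta0_div_rt.mono ?_).intervalIntegrable
    rw [uIcc_of_le hG.lt_endB.le]
    exact Icc_subset_Icc_left hG.endA_lt.le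
  · rw [uIcc_of_le hG.lt_endB.le] at hs
    have : s = w := by exact_mod_cast h
    linarith [hs.1]

theorem rt_ne_zero {w : ℂ} (hw : w ≠ 0) : rt w ≠ 0 := fun h => by
  have := rt_sq w
  rw [h] at this
  simp [eq_comm, hw] at this

/-- Both intervals are oriented toward `-1`, so `∫_𝔞^{-1} + ∫_𝔟^{-1}` equals the full `∫_𝔞^𝔟` minus
`2 ∫_{-1}^𝔟`. -/
theorem IsImpulseProfile.L_eq (hG : IsImpulseProfile G) {z : ℂ} (hz : z.im ≠ 0) :
    L G z = rt z / Real.pi * (segPart G z - 2 * innerPart G z + circlePart G z) := by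
  have hab : endA G ≤ endB G := by linarith [hG.endA_lt, hG.lt_endB]
  have hc : ContinuousOn (fun s : ℝ => theta0 G s / rt s / (s - z)) (Icc (endA G) (endB G)) :=
    hG.continuousOn_theta0_div_rt.div (by fun_prop) fun s _ => ofReal_sub_ne_zero hz s
  have hi : ∀ a ∈ Icc (endA G) (endB G), ∀ b ∈ Icc (endA G) (endB G),
      IntervalIntegrable (fun s : ℝ => theta0 G s / rt s / (s - z)) volume a b :=
    fun a ha b hb => (hc.mono (ordConnected_Icc.uIcc_subset ha hb)).intervalIntegrable
  have hm : (-1 : ℝ) ∈ Icc (endA G) (endB G) := ⟨hG.endA_lt.le, hG.lt_endB.le⟩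
  have hadd := intervalIntegral.integral_add_adjacent_intervals
    (hi _ (left_mem_Icc.2 hab) _ hm) (hi _ hm _ (right_mem_Icc.2 hab))
  have hcirc : ∀ φ : ℝ, theta0 G (Complex.exp (φ * Complex.I)) / rt (Complex.exp (φ * Complex.I)) /
      (Complex.exp (φ * Complex.I) - z) * (Complex.I * Complex.exp (φ * Complex.I)) =
      circleDensity G φ / (Complex.exp (φ * Complex.I) - z) := fun φ => by
    rw [circleDensity]
    ring
  rw [L, intPInf]
  simp only [hcirc]
  rw [intervalIntegral.integral_symm (-1) (endB G), segPart, innerPart, circlePart, ← hadd]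
  ring

/-- Since `w (rt w)⁻¹ = -rt w`, the segment term of `𝔪` cancels that of `L/2`. What remains has no
jump across `(𝔞, -1)`. -/
theorem IsImpulseProfile.gfun_eq (hG : IsImpulseProfile G) (x t : ℝ) {z : ℂ} (hz : z.im ≠ 0)
    (hz1 : 1 < ‖z‖) :
    gfun G x t z = rt z / (2 * Real.pi) * (circlePart G z - 2 * innerPart G z) +
      (rt z)⁻¹ * ((t - x) / 2) := by
  have hz0 : z ≠ 0 := fun h => hz (by simp [h])
  have hr := rt_ne_zero hz0
  have hr2 : z = -rt z ^ 2 := by rw [rt_sq, neg_neg]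
  have hint : ∫ s in (endA G)..(endB G), theta0 G s / (rt s * (s - z)) = segPart G z := by
    simp only [segPart, div_div]
  rw [gfun, hfun, mfun, if_neg (not_lt.2 hz1.le), if_neg (not_lt.2 hz1.le), hint, hG.L_eq hz]
  have e : (rt z)⁻¹ * (z / (2 * Real.pi) * segPart G z) =
      -(rt z / (2 * Real.pi) * segPart G z) := by
    have : (rt z)⁻¹ * z = -rt z := by
      nth_rw 2 [hr2]
      field_simp
    linear_combination (segPart G z / (2 * Real.pi)) * this
  linear_combination e

end SineGordon

/-! ### Boundary values and the closed form of the phase. -/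

namespace SineGordon

open MeasureTheory

variable {G : ℝ → ℝ}

/-- The square root of `y` whose imaginary part has the sign of `ε`; here `ε = ±1`. -/
noncomputable def signedRoot (ε : ℝ) (y : ℂ) : ℂ :=
  Real.sqrt ((‖y‖ + y.re) / 2) + ε * Real.sqrt ((‖y‖ - y.re) / 2) * Complex.I

theorem continuous_signedRoot (ε : ℝ) : Continuous (signedRoot ε) := by
  unfold signedRoot
  fun_prop

theorem cpow_half_eq_signedRoot_one {y : ℂ} (hy : 0 ≤ y.im) :
    y ^ (1 / 2 : ℂ) = signedRoot 1 y := by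
  rw [← Complex.re_add_im (y ^ (1 / 2 : ℂ)), one_div, Complex.cpow_inv_two_re,
    Complex.cpow_inv_two_im_eq_sqrt hy, signedRoot]
  simp

/-- From below, the principal root agrees with a function continuous on all of `ℂ`, which supplies
the boundary value on the cut. The case `y = 1` is needed where `cfun` vanishes. -/
theorem cpow_half_eq_signedRoot_neg_one {y : ℂ} (hy : y.im < 0 ∨ y = 1) :
    y ^ (1 / 2 : ℂ) = signedRoot (-1) y := by
  rcases hy with hy | rfl
  · rw [← Complex.re_add_im (y ^ (1 / 2 : ℂ)), one_div, Complex.cpow_inv_two_re,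
      Complex.cpow_inv_two_im_eq_neg_sqrt hy, signedRoot]
    simp
  · simp [signedRoot]

/-- For negative `y` the two roots are opposite imaginary numbers, so averaging the boundary values
produces the truncated real root. -/
theorem signedRoot_add_ofReal (y : ℝ) :
    signedRoot 1 (y : ℂ) + signedRoot (-1) (y : ℂ) = 2 * Real.sqrt y := by
  have h : Real.sqrt ((‖(y : ℂ)‖ + (y : ℂ).re) / 2) = Real.sqrt y := by
    rw [Complex.norm_real, Complex.ofReal_re, Real.norm_eq_abs]
    rcases le_total 0 y with h | h
    · rw [abs_of_nonneg h]
      congr 1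
      ring
    · rw [abs_of_nonpos h, Real.sqrt_eq_zero_of_nonpos h, neg_add_cancel]
      simp
  rw [signedRoot, signedRoot, h]
  push_cast
  ring

/-- The one-sided value of the Cauchy integral over `[𝔞, 𝔟]`. -/
noncomputable def segLim (G : ℝ → ℝ) (ε : ℝ) (z : ℂ) : ℂ :=
  Real.pi / 2 * ((1 + z) / z) * ∫ x in (0 : ℝ)..(xcrit G),
    (1 - signedRoot ε (1 - (cfun G x : ℂ) ^ 2 * (psq z)⁻¹))

theorem psq_ne_zero {z : ℂ} (h0 : z ≠ 0) (h1 : z ≠ -1) : psq z ≠ 0 :=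
  div_ne_zero (neg_ne_zero.2 (pow_ne_zero 2 fun h => h1 (eq_neg_of_add_eq_zero_left h))) h0

namespace IsImpulseProfile

theorem continuous_segLim_integrand (hG : IsImpulseProfile G) (ε : ℝ) :
    Continuous (Function.uncurry fun (ξ : ℂ) (x : ℝ) =>
      (1 - signedRoot ε (1 - (cfun G x : ℂ) ^ 2 * ξ))) := by
  have h1 := hG.continuous_cfun
  have h2 := continuous_signedRoot ε
  exact continuous_const.sub (h2.comp (by fun_prop))

theorem continuousAt_segLim (hG : IsImpulseProfile G) (ε : ℝ) {z : ℂ} (h0 : z ≠ 0) (h1 : z ≠ -1) :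
    ContinuousAt (segLim G ε) z := by
  have hp : ContinuousAt (fun z => (psq z)⁻¹) z := by
    refine ContinuousAt.inv₀ ?_ (psq_ne_zero h0 h1)
    have : ContinuousAt (fun z : ℂ => -(z + 1) ^ 2 / z) z :=
      ContinuousAt.div (by fun_prop) (by fun_prop) h0
    exact this
  have hI : Continuous fun ξ : ℂ => ∫ x in (0 : ℝ)..(xcrit G),
      (1 - signedRoot ε (1 - (cfun G x : ℂ) ^ 2 * ξ)) :=
    intervalIntegral.continuous_parametric_intervalIntegral_of_continuous'
      (hG.continuous_segLim_integrand ε) 0 (xcrit G)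
  have hz : ContinuousAt (fun z : ℂ => (Real.pi : ℂ) / 2 * ((1 + z) / z)) z :=
    continuousAt_const.mul (ContinuousAt.div (by fun_prop) (by fun_prop) h0)
  exact hz.mul (hI.continuousAt.comp hp)

/-- Outside the disc `psq` reverses the sign of the imaginary part, whereas `y ↦ 1 - c²/y` keeps it.
The upper half-plane thus goes with the root of nonpositive imaginary part. -/
theorem segPart_eq_of_im_pos (hG : IsImpulseProfile G) {z : ℂ} (hz : 0 < z.im) (hz1 : 1 < ‖z‖) :
    segPart G z = segLim G (-1) z := by
  have hz0 : z ≠ 0 := fun h => hz.ne' (by simp [h])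
  rw [segPart, hG.integral_theta0 hz.ne' hz1, segLim]
  congr 1
  refine intervalIntegral.integral_congr fun x _ => ?_
  simp only [← div_eq_mul_inv]
  rw [cpow_half_eq_signedRoot_neg_one]
  rcases eq_or_ne (cfun G x) 0 with hc | hc
  · right; simp [hc]
  · left
    have h1 : (psq z).im < 0 := by
      rw [psq_im hz0]
      nlinarith [one_sub_inv_normSq_pos hz1]
    rw [one_sub_sq_div_im]
    refine div_neg_of_neg_of_pos (mul_neg_of_pos_of_neg (by positivity) h1) ?_
    exact Complex.normSq_pos.2 fun h => h1.ne (by simp [h])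

theorem segPart_eq_of_im_neg (hG : IsImpulseProfile G) {z : ℂ} (hz : z.im < 0) (hz1 : 1 < ‖z‖) :
    segPart G z = segLim G 1 z := by
  have hz0 : z ≠ 0 := fun h => hz.ne (by simp [h])
  rw [segPart, hG.integral_theta0 hz.ne hz1, segLim]
  congr 1
  refine intervalIntegral.integral_congr fun x _ => ?_
  simp only [← div_eq_mul_inv]
  rw [cpow_half_eq_signedRoot_one]
  have h1 : 0 ≤ (psq z).im := by
    rw [psq_im hz0]
    nlinarith [one_sub_inv_normSq_pos hz1]
  rw [one_sub_sq_div_im]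
  exact div_nonneg (mul_nonneg (sq_nonneg _) h1) (Complex.normSq_nonneg _)

theorem segLim_add (hG : IsImpulseProfile G) {w : ℝ} (hw : w < -1) :
    Real.sqrt (-w) / Real.pi * ((segLim G (-1) w + segLim G 1 w) / 2) =
      (((Real.sqrt (-w) - (Real.sqrt (-w))⁻¹) * xcrit G - ∫ x in (0 : ℝ)..(xcrit G),
        Real.sqrt ((Real.sqrt (-w) - (Real.sqrt (-w))⁻¹) ^ 2 - cfun G x ^ 2)) / 2 : ℝ) := by
  set r := Real.sqrt (-w) with hr
  have hr1 : 1 < r := Real.lt_sqrt_of_sq_lt (by linarith)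
  have hr0 : 0 < r := by linarith
  have hrw : w = -r ^ 2 := by rw [hr, Real.sq_sqrt (by linarith)]; ring
  set p := r - r⁻¹ with hp
  have hp0 : 0 < p := by
    have := inv_lt_one_of_one_lt₀ hr1
    linarith
  have hpsq : psq (w : ℂ) = ((p ^ 2 : ℝ) : ℂ) := by
    rw [psq, hrw, hp]
    have : (r : ℂ) ≠ 0 := by exact_mod_cast hr0.ne'
    push_cast
    field_simp
    ring
  have hint : ∀ ε : ℝ, IntervalIntegrable (fun x =>
      1 - signedRoot ε (1 - (cfun G x : ℂ) ^ 2 * (psq w)⁻¹)) volume 0 (xcrit G) := fun ε =>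
    ((hG.continuous_segLim_integrand ε).comp
      (continuous_const.prodMk continuous_id)).intervalIntegrable _ _
  rw [segLim, segLim, ← mul_add, ← intervalIntegral.integral_add (hint _) (hint _)]
  have hpt : ∀ x ∈ uIcc 0 (xcrit G), (1 - signedRoot (-1) (1 - (cfun G x : ℂ) ^ 2 * (psq w)⁻¹)) +
      (1 - signedRoot 1 (1 - (cfun G x : ℂ) ^ 2 * (psq w)⁻¹)) =
      ((2 / p * (p - Real.sqrt (p ^ 2 - cfun G x ^ 2)) : ℝ) : ℂ) := by
    intro x _
    have e : 1 - (cfun G x : ℂ) ^ 2 * (psq w)⁻¹ = ((1 - cfun G x ^ 2 * (p ^ 2)⁻¹ : ℝ) : ℂ) := by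
      rw [hpsq]
      push_cast
      rfl
    have e2 : Real.sqrt (1 - cfun G x ^ 2 * (p ^ 2)⁻¹) = Real.sqrt (p ^ 2 - cfun G x ^ 2) / p := by
      rw [show 1 - cfun G x ^ 2 * (p ^ 2)⁻¹ = (p ^ 2 - cfun G x ^ 2) / p ^ 2 by field_simp,
        Real.sqrt_div' _ (sq_nonneg p), Real.sqrt_sq hp0.le]
    have h := signedRoot_add_ofReal (1 - cfun G x ^ 2 * (p ^ 2)⁻¹)
    rw [e2] at h
    rw [e]
    have hpc : (p : ℂ) ≠ 0 := by exact_mod_cast hp0.ne'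
    calc _ = 2 - (signedRoot 1 ((1 - cfun G x ^ 2 * (p ^ 2)⁻¹ : ℝ) : ℂ) +
        signedRoot (-1) ((1 - cfun G x ^ 2 * (p ^ 2)⁻¹ : ℝ) : ℂ)) := by ring
      _ = _ := by
        rw [h]
        push_cast
        field_simp
  have hsq : Continuous fun x => Real.sqrt (p ^ 2 - cfun G x ^ 2) := by
    have := hG.continuous_cfun
    fun_prop
  rw [intervalIntegral.integral_congr hpt, intervalIntegral.integral_ofReal,
    intervalIntegral.integral_const_mul, intervalIntegral.integral_sub (by simp)
      (hsq.intervalIntegrable _ _), intervalIntegral.integral_const]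
  generalize (∫ x in (0 : ℝ)..(xcrit G), Real.sqrt (p ^ 2 - cfun G x ^ 2)) = T
  have hk : (Real.sqrt (-w) : ℂ) * ((1 + w) / w) = p := by
    rw [← hr]
    have : (r : ℂ) ≠ 0 := by exact_mod_cast hr0.ne'
    rw [hrw, hp]
    push_cast
    field_simp
    ring
  have hpi : (Real.pi : ℂ) ≠ 0 := by exact_mod_cast Real.pi_ne_zero
  have hpc : (p : ℂ) ≠ 0 := by exact_mod_cast hp0.ne'
  simp only [smul_eq_mul, sub_zero]
  push_cast
  calc _ = ((r : ℂ) * ((1 + w) / w)) * (Real.pi / Real.pi) *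
        ((p : ℂ)⁻¹ * (xcrit G * p - T)) / 2 := by ring
    _ = _ := by
      rw [hk, div_self hpi]
      field_simp

theorem continuousAt_rt {w : ℝ} (hw : w < 0) : ContinuousAt rt (w : ℂ) := by
  have h : -(w : ℂ) ∈ Complex.slitPlane := by
    rw [← Complex.ofReal_neg, Complex.ofReal_mem_slitPlane]
    linarith
  exact (continuousAt_cpow_const h).comp (f := fun w : ℂ => -w)
    (continuous_neg.continuousAt)

/-- The phase on `(𝔞, -1)` in closed form. -/
theorem isPhaseValue (hG : IsImpulseProfile G) (x t : ℝ) {w : ℝ} (ha : endA G < w) (hw : w < -1) :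
    IsPhaseValue G x t w
      ((-((Real.sqrt (-w) - (Real.sqrt (-w))⁻¹) / 2) * (x - xcrit G) -
        (Real.sqrt (-w) + (Real.sqrt (-w))⁻¹) / 2 * t - (∫ x in (0 : ℝ)..(xcrit G),
        Real.sqrt ((Real.sqrt (-w) - (Real.sqrt (-w))⁻¹) ^ 2 - cfun G x ^ 2)) / 2 : ℝ) : ℂ) := by
  have hw0 : (w : ℂ) ≠ 0 := by
    have : w ≠ 0 := by linarith
    exact_mod_cast this
  have hw1 : (w : ℂ) ≠ -1 := by exact_mod_cast hw.ne
  have hn : 1 < ‖(w : ℂ)‖ := by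
    rw [Complex.norm_real, Real.norm_eq_abs, abs_of_neg (by linarith)]
    linarith
  have hev : ∀ᶠ z : ℂ in 𝓝 (w : ℂ), 1 < ‖z‖ := continuous_norm.continuousAt.eventually_const_lt hn
  have hrt := continuousAt_rt (show w < 0 by linarith)
  have hcirc := hG.continuousAt_circlePart hn.ne'
  have hinn := hG.continuousAt_innerPart hw
  have hLlim : ∀ ε : ℝ, ContinuousAt (fun z => rt z / Real.pi *
      (segLim G ε z - 2 * innerPart G z + circlePart G z)) (w : ℂ) := fun ε =>
    (hrt.div_const _).mul
      (((hG.continuousAt_segLim ε hw0 hw1).sub (hinn.const_mul 2)).add hcirc)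
  refine ⟨ha, hw, _, _, _, (hLlim (-1)).continuousWithinAt.tendsto.congr' ?_,
    (hLlim 1).continuousWithinAt.tendsto.congr' ?_,
    Tendsto.congr' (f₁ := fun z => rt z / (2 * Real.pi) * (circlePart G z - 2 * innerPart G z) +
      (rt z)⁻¹ * ((t - x) / 2)) ?_ (ContinuousAt.continuousWithinAt ?_).tendsto, ?_⟩
  · filter_upwards [self_mem_nhdsWithin, nhdsWithin_le_nhds hev] with z hz hz1
    rw [hG.L_eq (ne_of_gt hz), hG.segPart_eq_of_im_pos hz hz1]
  · filter_upwards [self_mem_nhdsWithin, nhdsWithin_le_nhds hev] with z hz hz1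
    rw [hG.L_eq (ne_of_lt hz), hG.segPart_eq_of_im_neg hz hz1]
  · have hre : ∀ᶠ z : ℂ in 𝓝 (w : ℂ), z.re ∈ Ioo (endA G) (-1) :=
      Complex.continuous_re.continuousAt.eventually_mem (Ioo_mem_nhds ha hw)
    filter_upwards [self_mem_nhdsWithin, nhdsWithin_le_nhds hev, nhdsWithin_le_nhds hre]
      with z hz hz1 hz2
    -- A real point with real part in `(𝔞, -1)` would lie on the contour.
    rw [hG.gfun_eq x t (fun him => hz (Or.inr ⟨z.re, ⟨hz2.1.le, ?_⟩, ?_⟩)) hz1]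
    · linarith [hz2.2, hG.lt_endB]
    · apply Complex.ext <;> simp [him]
  · exact ((hrt.div_const _).mul (hcirc.sub (hinn.const_mul 2))).add
      ((hrt.inv₀ (rt_ne_zero hw0)).mul continuousAt_const)
  -- The inner and circular parts cancel between the mean of `L` and `2𝔤`. The leftover `(rt w)⁻¹ (x
  -- - t)` combines with `2iQ` into the coefficients of `x` and `t`, and `x_crit` enters through
  -- `hseg`.
  · have hseg := hG.segLim_add hw
    rw [Q, E, D]
    rw [rt_ofReal (by linarith)]
    have hI : Complex.I ^ 2 = -1 := Complex.I_sq
    push_cast at hseg ⊢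
    linear_combination -hseg - ((Real.sqrt (-w) : ℂ) + (Real.sqrt (-w) : ℂ)⁻¹) / 2 * x * hI -
      ((Real.sqrt (-w) : ℂ) - (Real.sqrt (-w) : ℂ)⁻¹) / 2 * t * hI

end IsImpulseProfile
end SineGordon

/-! ### The remaining integral as `p³` times a holomorphic function of `p²`. -/

namespace SineGordon

open MeasureTheory

variable {G : ℝ → ℝ}

theorem integral_sqrt_one_sub : ∫ τ in (0 : ℝ)..1, Real.sqrt (1 - τ) = 2 / 3 := by
  rw [intervalIntegral.integral_comp_sub_left (fun τ => Real.sqrt τ) 1]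
  simp only [Real.sqrt_eq_rpow]
  rw [integral_rpow (Or.inl (by norm_num))]
  norm_num

/-- The weighted averages `∫₀¹ √(1 - τ) h(yτ) dτ` of a real-analytic function `h` extend
holomorphically in `y`. -/
theorem exists_holomorphic_average {h : ℝ → ℝ} (hh : AnalyticAt ℝ h 0) :
    ∃ (H : ℂ → ℂ) (ρ : ℝ), 0 < ρ ∧ DifferentiableOn ℂ H (Metric.ball 0 ρ) ∧
      ∀ y : ℝ, 0 ≤ y → y < ρ →
        H y = ((∫ τ in (0 : ℝ)..1, Real.sqrt (1 - τ) * h (y * τ) : ℝ) : ℂ) := by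
  obtain ⟨P, hP⟩ := hh
  rw [hasFPowerSeriesAt_iff] at hP
  obtain ⟨δ, hδ, hball⟩ := Metric.eventually_nhds_iff.1 hP
  set a : ℕ → ℝ := fun n => P.coeff n with ha
  set R := δ / 2 with hR
  have hR0 : 0 < R := half_pos hδ
  have hsum : ∀ y : ℝ, |y| < δ → HasSum (fun n => a n * y ^ n) (h y) := by
    intro y hy
    have := hball (y := y) (by simpa [Real.dist_eq] using hy)
    simpa [ha, mul_comm] using this
  -- Boundedness of the terms at radius `R` gives the geometric ratio `1/2` on the disc of radius `R
  -- / 2`.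
  obtain ⟨C, hC⟩ : ∃ C, ∀ n, |a n| * R ^ n ≤ C := by
    have h1 := (hsum R (by rw [abs_of_pos hR0]; linarith)).summable.tendsto_atTop_zero.norm
    obtain ⟨C, hC⟩ := h1.bddAbove_range
    refine ⟨C, fun n => ?_⟩
    have := hC (mem_range_self n)
    simpa [abs_of_pos hR0] using this
  have hC0 : 0 ≤ C := le_trans (by positivity) (hC 0)
  have hbd : ∀ n, ∀ y, 0 ≤ y → y ≤ R / 2 → |a n| * y ^ n ≤ C * (1 / 2) ^ n := by
    intro n y hy0 hy
    calc |a n| * y ^ n ≤ |a n| * (R / 2) ^ n := by gcongr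
      _ = |a n| * R ^ n * (1 / 2) ^ n := by rw [div_eq_mul_one_div, mul_pow]; ring
      _ ≤ _ := by gcongr; exact hC n
  have hgeo : Summable fun n : ℕ => C * (1 / 2 : ℝ) ^ n :=
    (summable_geometric_of_lt_one (by norm_num) (by norm_num)).mul_left C
  set B : ℕ → ℝ := fun n => ∫ τ in (0 : ℝ)..1, Real.sqrt (1 - τ) * τ ^ n with hB
  have hτ : ∀ n : ℕ, ∀ τ ∈ Ioc (0 : ℝ) 1, ‖Real.sqrt (1 - τ) * τ ^ n‖ ≤ 1 := by
    intro n τ hτ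
    rw [norm_mul, norm_pow, Real.norm_of_nonneg (Real.sqrt_nonneg _), Real.norm_of_nonneg hτ.1.le]
    exact mul_le_one₀ (Real.sqrt_le_one.2 (by linarith [hτ.1])) (pow_nonneg hτ.1.le n)
      (pow_le_one₀ hτ.1.le hτ.2)
  have hB1 : ∀ n, |B n| ≤ 1 := by
    intro n
    have := intervalIntegral.norm_integral_le_of_norm_le_const (a := (0 : ℝ)) (b := 1) (C := 1)
      (f := fun τ => Real.sqrt (1 - τ) * τ ^ n) (by
        rw [uIoc_of_le zero_le_one]
        exact hτ n)
    simpa using this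
  -- Integrating the power series of `h` termwise multiplies its coefficients by the moments `B n`,
  -- which are bounded by `1`.
  refine ⟨fun ζ => ∑' n, (a n * B n : ℝ) * ζ ^ n, R / 2, half_pos hR0, ?_, ?_⟩
  · refine Complex.differentiableOn_tsum_of_summable_norm hgeo (fun n => by fun_prop)
      Metric.isOpen_ball fun n w hw => ?_
    rw [mem_ball_zero_iff] at hw
    rw [norm_mul, norm_pow, Complex.norm_real, norm_mul, Real.norm_eq_abs, Real.norm_eq_abs]
    calc |a n| * |B n| * ‖w‖ ^ n ≤ |a n| * 1 * ‖w‖ ^ n := by gcongr; exact hB1 n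
      _ ≤ _ := by rw [mul_one]; exact hbd n _ (norm_nonneg _) hw.le
  · intro y hy0 hy
    have key : HasSum (fun n => ∫ τ in (0 : ℝ)..1, Real.sqrt (1 - τ) * (a n * (y * τ) ^ n))
        (∫ τ in (0 : ℝ)..1, Real.sqrt (1 - τ) * h (y * τ)) := by
      refine intervalIntegral.hasSum_integral_of_dominated_convergence
        (fun n _ => C * (1 / 2 : ℝ) ^ n) (fun n => ?_) (fun n => ?_) ?_ ?_ ?_
      · exact Continuous.aestronglyMeasurable (by fun_prop)
      · refine Eventually.of_forall fun τ hτ1 => ?_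
        rw [uIoc_of_le zero_le_one] at hτ1
        have h1 := hτ n τ hτ1
        have h2 := hbd n y hy0 hy.le
        calc ‖Real.sqrt (1 - τ) * (a n * (y * τ) ^ n)‖
            = (|a n| * y ^ n) * ‖Real.sqrt (1 - τ) * τ ^ n‖ := by
              rw [mul_pow]
              simp only [norm_mul, norm_pow, Real.norm_eq_abs, abs_of_nonneg hy0]
              ring
          _ ≤ (|a n| * y ^ n) * 1 := by gcongr
          _ ≤ _ := by rw [mul_one]; exact h2
      · exact Eventually.of_forall fun _ _ => hgeo
      · simp
      · refine Eventually.of_forall fun τ hτ1 => ?_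
        rw [uIoc_of_le zero_le_one] at hτ1
        refine (hsum (y * τ) ?_).mul_left _
        rw [abs_of_nonneg (mul_nonneg hy0 hτ1.1.le)]
        nlinarith [hτ1.2]
    have e : ∀ n, ∫ τ in (0 : ℝ)..1, Real.sqrt (1 - τ) * (a n * (y * τ) ^ n) =
        a n * B n * y ^ n := by
      intro n
      rw [hB]
      simp only
      rw [mul_comm (a n), mul_assoc, ← intervalIntegral.integral_mul_const]
      congr 1
      ext τ
      rw [mul_pow]
      ring
    simp only [e] at key
    rw [← key.tsum_eq]
    push_cast
    rfl

theorem mul_integral_sqrt_sub {p : ℝ} (hp : 0 ≤ p) (h : ℝ → ℝ) :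
    ∫ y in (0 : ℝ)..(p ^ 2), Real.sqrt (p ^ 2 - y) * h y =
      p ^ 3 * ∫ τ in (0 : ℝ)..1, Real.sqrt (1 - τ) * h (p ^ 2 * τ) := by
  have h1 := intervalIntegral.mul_integral_comp_mul_left (a := (0 : ℝ)) (b := 1) (p ^ 2)
    (f := fun y => Real.sqrt (p ^ 2 - y) * h y)
  rw [mul_zero, mul_one] at h1
  rw [← h1]
  have h2 : ∀ τ, Real.sqrt (p ^ 2 - p ^ 2 * τ) * h (p ^ 2 * τ) =
      p * (Real.sqrt (1 - τ) * h (p ^ 2 * τ)) := by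
    intro τ
    rw [show p ^ 2 - p ^ 2 * τ = p ^ 2 * (1 - τ) by ring, Real.sqrt_mul (sq_nonneg p),
      Real.sqrt_sq hp, mul_assoc]
  simp only [h2]
  rw [intervalIntegral.integral_const_mul]
  ring

namespace IsImpulseProfile

/-- Near `x_crit` the change of variables `y = G(x)² - 4` has a real-analytic Jacobian. -/
theorem exists_jacobian (hG : IsImpulseProfile G) :
    ∃ h : ℝ → ℝ, AnalyticAt ℝ h 0 ∧ ContinuousOn h (Ico 0 (qmax G ^ 2)) ∧ h 0 = 3 * nu G ∧
      ∀ x ∈ Ioc 0 (xcrit G), h (G x ^ 2 - 4) * (2 * G x * deriv G x) = -1 := by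
  obtain ⟨Γ, hΓ, heq, -, -⟩ := hG.scriptG_nice
  have hk := hG.kinks
  have h4 : 4 < G 0 ^ 2 := by nlinarith
  have hval : ∀ x ∈ Ioc 0 (xcrit G), Γ (4 + (G x ^ 2 - 4)) / ((4 + (G x ^ 2 - 4)) *
      Real.sqrt (G 0 ^ 2 - 4 - (G x ^ 2 - 4))) * (2 * G x * deriv G x) = -1 := by
    intro x hx
    have hx2 := hG.le_neg_two ⟨hx.1.le, hx.2⟩
    have h0x : G 0 < G x := hG.strictMonoOn self_mem_Ici hx.1.le hx.1
    have hd := hG.deriv_pos x hx.1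
    rw [add_sub_cancel, sub_sub_sub_cancel_right,
      heq _ ⟨by nlinarith, by nlinarith⟩, scriptG, Real.sqrt_sq_eq_abs,
      abs_of_nonpos (hG.nonpos x), neg_neg, hG.Ginv_apply hx.1.le]
    have hs : 0 < Real.sqrt (G 0 ^ 2 - G x ^ 2) := Real.sqrt_pos.2 (by nlinarith)
    have hGx : G x ≠ 0 := by linarith
    field_simp
  -- With `m = G(x)² = 4 + y`, dividing `𝒢(m)` by `m √(G(0)² - m)` leaves `1/(2√m G'(x)) = -dx/dy`.
  -- The denominator vanishes at `y = qmax²`, that is at `x = 0`, hence the half-open interval of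
  -- continuity.
  refine ⟨fun y => Γ (4 + y) / ((4 + y) * Real.sqrt (G 0 ^ 2 - 4 - y)), ?_, ?_, ?_, hval⟩
  · have h1 : AnalyticAt ℝ (fun y : ℝ => Γ (4 + y)) 0 := by
      have : AnalyticAt ℝ Γ (4 + 0) := hΓ _ ⟨by norm_num, by linarith⟩
      exact this.comp (f := fun y : ℝ => 4 + y) (by fun_prop)
    have h2 : AnalyticAt ℝ (fun y : ℝ => Real.sqrt (G 0 ^ 2 - 4 - y)) 0 := by
      have : AnalyticAt ℝ Real.sqrt (G 0 ^ 2 - 4 - 0) :=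
        (Real.contDiffAt_sqrt (by linarith)).analyticAt
      exact this.comp (f := fun y : ℝ => G 0 ^ 2 - 4 - y) (by fun_prop)
    refine h1.div (AnalyticAt.mul (by fun_prop) h2) ?_
    have : 0 < Real.sqrt (G 0 ^ 2 - 4 - 0) := Real.sqrt_pos.2 (by linarith)
    positivity
  · rw [hG.qmax_sq]
    refine ContinuousOn.div ?_ (by fun_prop) fun y hy => ?_
    · exact hΓ.continuousOn.comp (by fun_prop) fun y hy => ⟨by linarith [hy.1], by linarith [hy.2]⟩
    · have : 0 < Real.sqrt (G 0 ^ 2 - 4 - y) := Real.sqrt_pos.2 (by linarith [hy.2])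
      have := hy.1
      positivity
  · have h := hval _ ⟨hG.xcrit_pos, le_rfl⟩
    have hd := hG.deriv_pos _ hG.xcrit_pos
    rw [hG.apply_xcrit, show ((-2 : ℝ)) ^ 2 - 4 = 0 by norm_num] at h
    rw [nu]
    simp only
    generalize Γ (4 + 0) / ((4 + 0) * Real.sqrt (G 0 ^ 2 - 4 - 0)) = V at h ⊢
    field_simp
    linarith

/-- The integrand vanishes until `G(x) = -√(p² + 4)`. As `p < qmax`, this point is positive, so the
change of variables `y = G(x)² - 4` avoids the singular Jacobian at `x = 0`. -/
theorem integral_sqrt_sub_cfun (hG : IsImpulseProfile G) {h : ℝ → ℝ}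
    (hc : ContinuousOn h (Ico 0 (qmax G ^ 2)))
    (hj : ∀ x ∈ Ioc 0 (xcrit G), h (G x ^ 2 - 4) * (2 * G x * deriv G x) = -1)
    {p : ℝ} (hp : 0 < p) (hpq : p < qmax G) :
    ∫ x in (0 : ℝ)..(xcrit G), Real.sqrt (p ^ 2 - cfun G x ^ 2) =
      p ^ 3 * ∫ τ in (0 : ℝ)..1, Real.sqrt (1 - τ) * h (p ^ 2 * τ) := by
  have hq2 : p ^ 2 < G 0 ^ 2 - 4 := by
    rw [← hG.qmax_sq]
    gcongr
  set u := Real.sqrt (p ^ 2 + 4) with hu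
  have hu2 : u ^ 2 = p ^ 2 + 4 := Real.sq_sqrt (by positivity)
  have hu0 : 2 < u := Real.lt_sqrt_of_sq_lt (by nlinarith)
  have hu1 : u < -G 0 := by
    refine lt_of_pow_lt_pow_left₀ 2 (by linarith [hG.nonpos 0]) ?_
    rw [neg_sq]
    linarith
  have hy : -u ∈ Ico (G 0) 0 := ⟨by linarith, by linarith⟩
  set X := Ginv G (-u) with hX
  have hGX : G X = -u := hG.apply_Ginv hy
  have hX0 : 0 < X := by
    refine (hG.Ginv_nonneg hy).lt_of_ne fun h0 => ?_
    rw [← hX] at h0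
    rw [← h0] at hGX
    linarith
  have hXc : X ≤ xcrit G := by
    rw [← hG.strictMonoOn.le_iff_le hX0.le hG.xcrit_nonneg, hGX, hG.apply_xcrit]
    linarith
  have hcont : Continuous fun x => Real.sqrt (p ^ 2 - cfun G x ^ 2) := by
    have := hG.continuous_cfun
    fun_prop
  have hzero : ∫ x in (0 : ℝ)..X, Real.sqrt (p ^ 2 - cfun G x ^ 2) = 0 := by
    rw [intervalIntegral.integral_congr (g := fun _ => 0), intervalIntegral.integral_zero]
    intro x hx
    rw [uIcc_of_le hX0.le] at hx
    have h1 : G x ≤ -u := by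
      rw [← hGX]
      exact hG.strictMonoOn.monotoneOn hx.1 hX0.le hx.2
    apply Real.sqrt_eq_zero_of_nonpos
    rw [hG.cfun_sq ⟨hx.1, hx.2.trans hXc⟩]
    nlinarith
  rw [← intervalIntegral.integral_add_adjacent_intervals (hcont.intervalIntegrable 0 X)
    (hcont.intervalIntegrable X _), hzero, zero_add, ← mul_integral_sqrt_sub hp.le]
  have hsub := intervalIntegral.integral_deriv_smul_comp' (a := X) (b := xcrit G)
    (f := fun x => G x ^ 2 - 4) (f' := fun x => 2 * G x * deriv G x)
    (g := fun y => Real.sqrt (p ^ 2 - y) * h y) (fun x _ => ?_) ?_ ?_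
  · simp only [hGX, hG.apply_xcrit, neg_sq, hu2, add_sub_cancel_right] at hsub
    rw [show (2 : ℝ) ^ 2 - 4 = 0 by norm_num] at hsub
    rw [intervalIntegral.integral_symm (p ^ 2) 0, ← hsub, ← intervalIntegral.integral_neg]
    refine intervalIntegral.integral_congr fun x hx => ?_
    rw [uIcc_of_le hXc] at hx
    have hx0 : x ∈ Ioc 0 (xcrit G) := ⟨hX0.trans_le hx.1, hx.2⟩
    have h1 := hj x hx0
    simp only [Function.comp, smul_eq_mul]
    rw [hG.cfun_sq ⟨hx0.1.le, hx0.2⟩]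
    linear_combination Real.sqrt (p ^ 2 - (G x ^ 2 - 4)) * h1
  · have h1 := (hG.contDiff.differentiable one_ne_zero x).hasDerivAt
    refine ((h1.pow 2).sub_const 4).congr_deriv ?_
    simp
  · have h1 := hG.contDiff.continuous_deriv le_rfl
    have h2 := hG.continuous
    fun_prop
  · refine ContinuousOn.mul (by fun_prop) (hc.mono ?_)
    rintro _ ⟨x, hx, rfl⟩
    rw [uIcc_of_le hXc] at hx
    have h1 := hG.le_neg_two ⟨hX0.le.trans hx.1, hx.2⟩
    have h2 : -u ≤ G x := by
      rw [← hGX]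
      exact hG.strictMonoOn.monotoneOn hX0.le (hX0.le.trans hx.1) hx.1
    rw [hG.qmax_sq]
    constructor <;> simp only <;> nlinarith

end IsImpulseProfile
end SineGordon

/-! ### Fourth-order expansions at `w = -1`. -/

namespace SineGordon

open Asymptotics

theorem neg_mem_slitPlane_of_mem_ball {w : ℂ} (hw : w ∈ Metric.ball (-1 : ℂ) 1) :
    -w ∈ Complex.slitPlane := by
  left
  rw [mem_ball_iff_norm, sub_neg_eq_add] at hw
  have h1 := (Complex.re_le_norm (w + 1)).trans_lt hw
  simp only [Complex.add_re, Complex.one_re] at h1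
  rw [Complex.neg_re]
  linarith

theorem differentiableAt_rt {w : ℂ} (hw : w ∈ Metric.ball (-1 : ℂ) 1) :
    DifferentiableAt ℂ rt w :=
  (differentiableAt_id.neg).cpow_const (neg_mem_slitPlane_of_mem_ball hw)

theorem ne_zero_of_mem_ball {w : ℂ} (hw : w ∈ Metric.ball (-1 : ℂ) 1) : w ≠ 0 := by
  rintro rfl
  exact Complex.slitPlane_ne_zero (neg_mem_slitPlane_of_mem_ball hw) neg_zero

theorem rt_neg_one : rt (-1) = 1 := by simp [rt]

/-- `p(w) = (-w)^{1/2} - (-w)^{-1/2}`. -/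
noncomputable def pfun (w : ℂ) : ℂ := rt w - (rt w)⁻¹

theorem differentiableAt_inv_rt {w : ℂ} (hw : w ∈ Metric.ball (-1 : ℂ) 1) :
    DifferentiableAt ℂ (fun w => (rt w)⁻¹) w :=
  (differentiableAt_rt hw).inv (rt_ne_zero (ne_zero_of_mem_ball hw))

theorem differentiableAt_pfun {w : ℂ} (hw : w ∈ Metric.ball (-1 : ℂ) 1) :
    DifferentiableAt ℂ pfun w :=
  (differentiableAt_rt hw).sub (differentiableAt_inv_rt hw)

theorem rt_eq_mul_inv {w : ℂ} (hw : w ≠ 0) : rt w = -w * (rt w)⁻¹ := by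
  have := rt_ne_zero hw
  rw [← rt_sq]
  field_simp

theorem pfun_eq {w : ℂ} (hw : w ≠ 0) : pfun w = -(w + 1) * (rt w)⁻¹ := by
  rw [pfun]
  nth_rw 1 [rt_eq_mul_inv hw]
  ring

theorem isBigO_mul_continuousAt {f g h : ℂ → ℂ} {n : ℕ} {a : ℂ}
    (hf : f =O[𝓝 a] fun w => (w - a) ^ n) (hg : ContinuousAt g a)
    (h_eq : h =ᶠ[𝓝 a] fun w => f w * g w) : h =O[𝓝 a] fun w => (w - a) ^ n := by
  have := hf.mul (hg.norm.isBoundedUnder_le.isBigO_one ℂ)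
  simpa using h_eq.trans_isBigO this

/-- The binomial expansion of `(1 - z)^{-1/2}` to fourth order. -/
noncomputable def invSqrtPoly (z : ℂ) : ℂ :=
  1 + z / 2 + 3 / 8 * z ^ 2 + 5 / 16 * z ^ 3 + 35 / 128 * z ^ 4

theorem eventually_mem_ball_neg_one : ∀ᶠ w in 𝓝 (-1 : ℂ), w ∈ Metric.ball (-1 : ℂ) 1 :=
  Metric.ball_mem_nhds _ one_pos

theorem self_mem_ball_neg_one : (-1 : ℂ) ∈ Metric.ball (-1 : ℂ) 1 := Metric.mem_ball_self one_pos

/-- With `u = (rt w)⁻¹` and `P` the polynomial, `-w u² = 1` gives `-w (u - P)(u + P) = 1 + w P²`,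
which is divisible by `(w + 1)⁵`. The quotient is the quartic below, and `u + P` is `2` at `-1`. -/
theorem inv_rt_sub_isBigO :
    (fun w => (rt w)⁻¹ - invSqrtPoly (w + 1)) =O[𝓝 (-1)] fun w => (w - (-1)) ^ 5 := by
  have hu := (differentiableAt_inv_rt self_mem_ball_neg_one).continuousAt
  have hs : ContinuousAt (fun w => (rt w)⁻¹ + invSqrtPoly (w + 1)) (-1) := by
    refine hu.add ?_
    unfold invSqrtPoly
    fun_prop
  have hs0 : (rt (-1))⁻¹ + invSqrtPoly (-1 + 1) ≠ 0 := by
    simp [rt_neg_one, invSqrtPoly]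
  refine isBigO_mul_continuousAt (isBigO_refl _ _) (g := fun w =>
    (63 / 128 + 105 / 512 * (w + 1) + 135 / 1024 * (w + 1) ^ 2 + 1575 / 16384 * (w + 1) ^ 3 +
      1225 / 16384 * (w + 1) ^ 4) / (-w * ((rt w)⁻¹ + invSqrtPoly (w + 1)))) ?_ ?_
  · refine ContinuousAt.div (by fun_prop) (continuousAt_id.neg.mul hs) ?_
    exact mul_ne_zero (by simp) hs0
  · filter_upwards [eventually_mem_ball_neg_one, hs.eventually_ne hs0] with w hw hw2
    have hw0 := ne_zero_of_mem_ball hw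
    have h2 : (rt w)⁻¹ ^ 2 = -w⁻¹ := by rw [inv_pow, rt_sq, inv_neg]
    rw [← mul_div_assoc, eq_div_iff (mul_ne_zero (neg_ne_zero.2 hw0) hw2)]
    have h3 : w * (rt w)⁻¹ ^ 2 = -1 := by rw [h2]; field_simp
    rw [invSqrtPoly]
    linear_combination -h3

theorem neg_half_pfun_isBigO :
    (fun w => -(pfun w / 2) - (1 / 2 * (w + 1) + 1 / 4 * (w + 1) ^ 2 + 3 / 16 * (w + 1) ^ 3 +
      5 / 32 * (w + 1) ^ 4)) =O[𝓝 (-1)] fun w => (w - (-1)) ^ 5 := by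
  have h1 := isBigO_mul_continuousAt inv_rt_sub_isBigO (g := fun w => (w + 1) / 2)
    (by fun_prop) EventuallyEq.rfl
  -- The factor `(w + 1)/2` raises the degree of the polynomial to five; `35/256` is the surplus top
  -- coefficient.
  have h2 := isBigO_mul_continuousAt (isBigO_refl (fun w : ℂ => (w - (-1)) ^ 5) (𝓝 (-1)))
    (g := fun _ => 35 / 256) (by fun_prop) EventuallyEq.rfl
  refine (h1.add h2).congr' ?_ EventuallyEq.rfl
  filter_upwards [eventually_mem_ball_neg_one] with w hw
  rw [pfun_eq (ne_zero_of_mem_ball hw), invSqrtPoly]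
  ring

theorem neg_half_rt_add_inv_isBigO :
    (fun w => -((rt w + (rt w)⁻¹) / 2) - (-1 - 1 / 8 * (w + 1) ^ 2 - 1 / 8 * (w + 1) ^ 3 -
      15 / 128 * (w + 1) ^ 4)) =O[𝓝 (-1)] fun w => (w - (-1)) ^ 5 := by
  have h1 := isBigO_mul_continuousAt inv_rt_sub_isBigO (g := fun w => (w - 1) / 2)
    (by fun_prop) EventuallyEq.rfl
  have h2 := isBigO_mul_continuousAt (isBigO_refl (fun w : ℂ => (w - (-1)) ^ 5) (𝓝 (-1)))
    (g := fun _ => 35 / 256) (by fun_prop) EventuallyEq.rfl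
  refine (h1.add h2).congr' ?_ EventuallyEq.rfl
  filter_upwards [eventually_mem_ball_neg_one] with w hw
  have h := rt_eq_mul_inv (ne_zero_of_mem_ball hw)
  rw [invSqrtPoly]
  linear_combination (1 / 2) * h

/-- As `p = -(w + 1) u` with `u = (rt w)⁻¹`, the function is `(w + 1)³ u³ H(p²)/2`. Here `H(p²) = 2ν
+ O((w + 1)²)` and `u³ = 1 + (3/2)(w + 1) + O((w + 1)²)`, so only `H 0` enters through fourth order.
-/
theorem cube_isBigO {H : ℂ → ℂ} {ν : ℂ} (hH : DifferentiableAt ℂ H 0) (h0 : H 0 = 2 * ν) :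
    (fun w => -(pfun w ^ 3 * H (pfun w ^ 2) / 2) - (ν * (w + 1) ^ 3 + 3 / 2 * ν * (w + 1) ^ 4))
      =O[𝓝 (-1)] fun w => (w - (-1)) ^ 5 := by
  have hu := (differentiableAt_inv_rt self_mem_ball_neg_one).continuousAt
  have hp := (differentiableAt_pfun self_mem_ball_neg_one).continuousAt
  have hp0 : pfun (-1) ^ 2 = 0 := by simp [pfun, rt_neg_one]
  have ht : Tendsto (fun w => pfun w ^ 2) (𝓝 (-1)) (𝓝 0) := by
    have := (hp.pow 2).tendsto
    rwa [Pi.pow_apply, hp0] at this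
  have hO : (fun w => H (pfun w ^ 2) - 2 * ν) =O[𝓝 (-1)] fun w => pfun w ^ 2 := by
    have := hH.isBigO_sub.comp_tendsto ht
    simpa [Function.comp_def, h0] using this
  have hP2 : (fun w => pfun w ^ 2) =O[𝓝 (-1)] fun w => (w - (-1)) ^ 2 := by
    refine isBigO_mul_continuousAt (isBigO_refl _ _) (g := fun w => (rt w)⁻¹ ^ 2) (hu.pow 2) ?_
    filter_upwards [eventually_mem_ball_neg_one] with w hw
    rw [pfun_eq (ne_zero_of_mem_ball hw)]
    ring
  have h1 := ((isBigO_refl (fun w : ℂ => (w - (-1)) ^ 3) (𝓝 (-1))).mul (hO.trans hP2))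
  simp only [← pow_add] at h1
  have h1' := isBigO_mul_continuousAt h1 (g := fun w => (rt w)⁻¹ ^ 3 / 2)
    ((hu.pow 3).div_const 2) EventuallyEq.rfl
  have hU : (fun w => (rt w)⁻¹ - (1 + (w + 1) / 2)) =O[𝓝 (-1)] fun w => (w - (-1)) ^ 2 := by
    have h5 : (fun w : ℂ => (w - (-1)) ^ 5) =O[𝓝 (-1)] fun w : ℂ => (w - (-1)) ^ 2 :=
      isBigO_mul_continuousAt (isBigO_refl _ _) (g := fun w => (w + 1) ^ 3) (by fun_prop)
        (Eventually.of_forall fun w => by ring)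
    have h6 := isBigO_mul_continuousAt (isBigO_refl (fun w : ℂ => (w - (-1)) ^ 2) (𝓝 (-1)))
      (g := fun w => 3 / 8 + 5 / 16 * (w + 1) + 35 / 128 * (w + 1) ^ 2) (by fun_prop)
      EventuallyEq.rfl
    refine ((inv_rt_sub_isBigO.trans h5).add h6).congr_left fun w => ?_
    rw [invSqrtPoly]
    ring
  have hU3 : (fun w => ν * ((rt w)⁻¹ ^ 3 - (1 + 3 / 2 * (w + 1)))) =O[𝓝 (-1)]
      fun w => (w - (-1)) ^ 2 := by
    have h7 := isBigO_mul_continuousAt hU (g := fun w => (rt w)⁻¹ ^ 2 +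
      (rt w)⁻¹ * (1 + (w + 1) / 2) + (1 + (w + 1) / 2) ^ 2)
      (((hu.pow 2).add (hu.mul (by fun_prop))).add (by fun_prop)) EventuallyEq.rfl
    have h8 := isBigO_mul_continuousAt (isBigO_refl (fun w : ℂ => (w - (-1)) ^ 2) (𝓝 (-1)))
      (g := fun w => 3 / 4 + (w + 1) / 8) (by fun_prop) EventuallyEq.rfl
    refine ((h7.add h8).const_mul_left ν).congr_left fun w => ?_
    ring
  have h2 := ((isBigO_refl (fun w : ℂ => (w - (-1)) ^ 3) (𝓝 (-1))).mul hU3)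
  simp only [← pow_add] at h2
  refine (h1'.add h2).congr' ?_ EventuallyEq.rfl
  filter_upwards [eventually_mem_ball_neg_one] with w hw
  rw [pfun_eq (ne_zero_of_mem_ball hw)]
  ring

theorem pfun_ofReal {w : ℝ} (hw : w ≤ 0) :
    pfun (w : ℂ) = ((Real.sqrt (-w) - (Real.sqrt (-w))⁻¹ : ℝ) : ℂ) := by
  rw [pfun, rt_ofReal hw]
  push_cast
  rfl

theorem hasSum_taylor {f : ℂ → ℂ} {ρ : ℝ} (hf : DifferentiableOn ℂ f (Metric.ball (-1) ρ))
    {w : ℂ} (hw : w ∈ Metric.ball (-1 : ℂ) ρ) :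
    HasSum (fun n : ℕ => (n.factorial : ℂ)⁻¹ * iteratedDeriv n f (-1) * (w + 1) ^ n) (f w) := by
  have := Complex.hasSum_taylorSeries_on_ball hf hw
  rw [show (fun n : ℕ => (n.factorial : ℂ)⁻¹ * iteratedDeriv n f (-1) * (w + 1) ^ n) =
    fun n : ℕ => (n.factorial : ℂ)⁻¹ • (w - -1) ^ n • iteratedDeriv n f (-1) from funext fun n => by
      simp only [smul_eq_mul, sub_neg_eq_add]
      ring]
  exact this

end SineGordon

/-! ### Assembly of the continuation and its expansion. -/

open SineGordon in
/-- The phase function `k(·; x, t)`, given for real `w < -1` by its boundary-value formula,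
continues to an analytic function near `w = -1` with the stated Taylor expansion; all Taylor
coefficients are (affine) linear in `Δx` and `t`, and the error term is uniform for bounded
`Δx` and `t`. -/
theorem mainTheorem6 (G : ℝ → ℝ) (hG : SineGordon.IsImpulseProfile G) :
    0 < SineGordon.xcrit G ∧ G (SineGordon.xcrit G) = -2 ∧ 0 < SineGordon.nu G ∧
    ∃ (k : ℝ → ℝ → ℂ → ℂ) (ρ : ℝ), 0 < ρ ∧
      (∀ x t : ℝ, AnalyticOnNhd ℂ (k x t) (Metric.ball (-1) ρ)) ∧
      (∀ x t w : ℝ, -1 - ρ < w → w < -1 → SineGordon.IsPhaseValue G x t w (k x t w)) ∧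
      (∃ α β γ : ℕ → ℂ, ∀ x t : ℝ, ∀ w ∈ Metric.ball (-1 : ℂ) ρ,
        HasSum (fun n : ℕ => (α n * ((x - SineGordon.xcrit G : ℝ) : ℂ) + β n * (t : ℂ) + γ n) *
          (w + 1) ^ n) (k x t w)) ∧
      (∀ R : ℝ, ∃ M δ : ℝ, 0 < δ ∧ ∀ x t : ℝ, |x - SineGordon.xcrit G| ≤ R → |t| ≤ R →
        ∀ w ∈ Metric.ball (-1 : ℂ) δ,
          ‖k x t w - SineGordon.taylorPoly (SineGordon.nu G) (x - SineGordon.xcrit G) t (w + 1)‖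
            ≤ M * ‖w + 1‖ ^ 5) := by
  refine ⟨hG.xcrit_pos, hG.apply_xcrit, hG.nu_pos, ?_⟩
  obtain ⟨h, hha, hhc, hh0, hhj⟩ := hG.exists_jacobian
  obtain ⟨H, ρ₀, hρ₀, hHd, hH⟩ := exists_holomorphic_average hha
  have hHat : DifferentiableAt ℂ H 0 :=
    (hHd 0 (Metric.mem_ball_self hρ₀)).differentiableAt (Metric.ball_mem_nhds 0 hρ₀)
  have hH0 : H 0 = 2 * (nu G : ℂ) := by
    have := hH 0 le_rfl hρ₀
    simp only [zero_mul, intervalIntegral.integral_mul_const, integral_sqrt_one_sub, hh0,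
      Complex.ofReal_zero] at this
    rw [this]
    push_cast
    ring
  set A : ℂ → ℂ := fun w => -(pfun w / 2) with hA
  set B : ℂ → ℂ := fun w => -((rt w + (rt w)⁻¹) / 2) with hB
  set C : ℂ → ℂ := fun w => -(pfun w ^ 3 * H (pfun w ^ 2) / 2) with hC
  -- The disc must keep `rt` off its cut, keep `p²` inside the domain of `H` and below `qmax²`, and
  -- stay to the right of `𝔞`. None of these conditions involves `x` or `t`.
  obtain ⟨ρ, hρ, hρ1⟩ : ∃ ρ > 0, ∀ w ∈ Metric.ball (-1 : ℂ) ρ, w ∈ Metric.ball (-1 : ℂ) 1 ∧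
      pfun w ^ 2 ∈ Metric.ball 0 (min ρ₀ (qmax G ^ 2)) ∧ endA G < w.re := by
    have hp := (differentiableAt_pfun self_mem_ball_neg_one).continuousAt.pow 2
    have hp0 : pfun (-1) ^ 2 = 0 := by simp [pfun, rt_neg_one]
    have e1 : ∀ᶠ w in 𝓝 (-1 : ℂ), pfun w ^ 2 ∈ Metric.ball 0 (min ρ₀ (qmax G ^ 2)) := by
      refine hp.eventually_mem (Metric.isOpen_ball.mem_nhds ?_)
      rw [Pi.pow_apply, hp0]
      exact Metric.mem_ball_self (lt_min hρ₀ (pow_pos hG.qmax_pos 2))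
    have e2 : ∀ᶠ w in 𝓝 (-1 : ℂ), endA G < w.re :=
      Complex.continuous_re.continuousAt.eventually_const_lt (by simpa using hG.endA_lt)
    obtain ⟨ρ, hρ, h⟩ := Metric.eventually_nhds_iff_ball.1
      (eventually_mem_ball_neg_one.and (e1.and e2))
    exact ⟨ρ, hρ, h⟩
  have hAd : DifferentiableOn ℂ A (Metric.ball (-1) ρ) := fun w hw =>
    ((differentiableAt_pfun (hρ1 w hw).1).div_const 2).neg.differentiableWithinAt
  have hBd : DifferentiableOn ℂ B (Metric.ball (-1) ρ) := fun w hw =>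
    (((differentiableAt_rt (hρ1 w hw).1).add (differentiableAt_inv_rt (hρ1 w hw).1)).div_const
      2).neg.differentiableWithinAt
  have hCd : DifferentiableOn ℂ C (Metric.ball (-1) ρ) := fun w hw => by
    have h1 := differentiableAt_pfun (hρ1 w hw).1
    have h2 : pfun w ^ 2 ∈ Metric.ball (0 : ℂ) ρ₀ :=
      Metric.ball_subset_ball (min_le_left _ _) (hρ1 w hw).2.1
    have h3 : DifferentiableAt ℂ H (pfun w ^ 2) :=
      (hHd _ h2).differentiableAt (Metric.isOpen_ball.mem_nhds h2)
    have h4 : DifferentiableAt ℂ (fun w => H (pfun w ^ 2)) w :=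
      h3.comp (f := fun w => pfun w ^ 2) w (h1.pow 2)
    exact (((h1.pow 3).mul h4).div_const 2).neg.differentiableWithinAt
  refine ⟨fun x t w => A w * ((x - xcrit G : ℝ) : ℂ) + B w * (t : ℂ) + C w, ρ, hρ, ?_, ?_, ?_, ?_⟩
  · intro x t
    exact (((hAd.mul_const _).add (hBd.mul_const _)).add hCd).analyticOnNhd Metric.isOpen_ball
  · intro x t w hw1 hw2
    have hwb : (w : ℂ) ∈ Metric.ball (-1 : ℂ) ρ := by
      rw [mem_ball_iff_norm, sub_neg_eq_add, ← Complex.ofReal_one, ← Complex.ofReal_add,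
        Complex.norm_real, Real.norm_eq_abs, abs_lt]
      constructor <;> linarith
    obtain ⟨-, hb, ha⟩ := hρ1 _ hwb
    rw [Complex.ofReal_re] at ha
    have hr1 : 1 < Real.sqrt (-w) := Real.lt_sqrt_of_sq_lt (by linarith)
    have hp0 : 0 < Real.sqrt (-w) - (Real.sqrt (-w))⁻¹ := by
      have := inv_lt_one_of_one_lt₀ hr1
      linarith
    rw [pfun_ofReal (by linarith), mem_ball_zero_iff, ← Complex.ofReal_pow, Complex.norm_real,
      Real.norm_of_nonneg (sq_nonneg _), lt_min_iff] at hb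
    convert hG.isPhaseValue x t ha hw2 using 1
    rw [hG.integral_sqrt_sub_cfun hhc hhj hp0
      (lt_of_pow_lt_pow_left₀ 2 hG.qmax_pos.le hb.2)]
    simp only [hA, hB, hC]
    rw [pfun_ofReal (by linarith), ← Complex.ofReal_pow _ 2, hH _ (sq_nonneg _) hb.1,
      rt_ofReal (by linarith)]
    push_cast
    ring
  · refine ⟨fun n => (n.factorial : ℂ)⁻¹ * iteratedDeriv n A (-1),
      fun n => (n.factorial : ℂ)⁻¹ * iteratedDeriv n B (-1),
      fun n => (n.factorial : ℂ)⁻¹ * iteratedDeriv n C (-1), fun x t w hw => ?_⟩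
    have h1 := (((hasSum_taylor hAd hw).mul_right ((x - xcrit G : ℝ) : ℂ)).add
      ((hasSum_taylor hBd hw).mul_right (t : ℂ))).add (hasSum_taylor hCd hw)
    simp only [add_mul]
    simpa only [mul_right_comm _ _ ((w + 1) ^ _)] using h1
  · intro R
    obtain ⟨MA, hMA⟩ := neg_half_pfun_isBigO.bound
    obtain ⟨MB, hMB⟩ := neg_half_rt_add_inv_isBigO.bound
    obtain ⟨MC, hMC⟩ := (cube_isBigO hHat hH0).bound
    obtain ⟨δ, hδ, hb⟩ := Metric.eventually_nhds_iff_ball.1 (hMA.and (hMB.and hMC))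
    -- The remainder is affine in `Δx` and `t` with the three fixed remainders as coefficients, so
    -- `δ` does not even depend on `R`.
    refine ⟨R * MA + R * MB + MC, δ, hδ, fun x t hx ht w hw => ?_⟩
    obtain ⟨b1, b2, b3⟩ := hb w hw
    simp only [sub_neg_eq_add, norm_pow] at b1 b2 b3
    set a := A w - (1 / 2 * (w + 1) + 1 / 4 * (w + 1) ^ 2 + 3 / 16 * (w + 1) ^ 3 +
      5 / 32 * (w + 1) ^ 4) with ha
    set b := B w - (-1 - 1 / 8 * (w + 1) ^ 2 - 1 / 8 * (w + 1) ^ 3 -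
      15 / 128 * (w + 1) ^ 4) with hb'
    set c := C w - (nu G * (w + 1) ^ 3 + 3 / 2 * nu G * (w + 1) ^ 4) with hc
    have e : A w * ((x - xcrit G : ℝ) : ℂ) + B w * (t : ℂ) + C w -
        taylorPoly (nu G) (x - xcrit G) t (w + 1) = a * ((x - xcrit G : ℝ) : ℂ) + b * (t : ℂ) + c := by
      rw [ha, hb', hc, taylorPoly]
      ring
    simp only
    rw [e]
    calc _ ≤ ‖a‖ * |x - xcrit G| + ‖b‖ * |t| + ‖c‖ := by
          refine (norm_add₃_le).trans ?_
          rw [norm_mul, norm_mul, Complex.norm_real, Complex.norm_real, Real.norm_eq_abs,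
            Real.norm_eq_abs]
      _ ≤ (MA * ‖w + 1‖ ^ 5) * R + (MB * ‖w + 1‖ ^ 5) * R + MC * ‖w + 1‖ ^ 5 := by
          gcongr <;> first | exact (norm_nonneg _).trans b1 | exact (norm_nonneg _).trans b2
      _ = _ := by ring
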